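/- Let $d\ge 0$, $M\ge 0$, $N\ge 1$, $r\ge N+1$ be integers, $D\subseteq\mathbb R^d$ open, $T>0$ and $\varepsilon_0>0$. Let $\theta_1,\dots,\theta_M:D\to\mathbb R$ be $C^r$ functions with $0<\theta_1(x)<\dots<\theta_M(x)<T$ for all $x\in D$, and put $\theta_0\equiv 0$, $\theta_{M+1}\equiv T$. For $1\le i\le N$ and $0\le j\le M$ let $F_i^j:\mathbb R\times D\to\mathbb R^d$ and $R^j:\mathbb R\times D\times(-\varepsilon_0,\varepsilon_0)\to\mathbb R^d$ be $C^r$ functions that are $T$-periodic in $t\in\mathbb R$. Consider the $T$-periodic nonsmooth system $$\dot x=\sum_{i=1}^N\varepsilon^iF_i(t,x)+\varepsilon^{N+1}R(t,x,\varepsilon),\qquad(1)$$ where $F_i(t,x)=F_i^j(t,x)$ and $R(t,x,\varepsilon)=R^j(t,x,\varepsilon)$ for $\theta_j(x)<t<\theta_{j+1}(x)$, $j=0,\dots,M$. A solution of (1) on $[0,T]$ is an absolutely continuous function with values in $D$ that satisfies (1) for almost every $t$, where on a switching surface $t=\theta_j(x)$, $1\le j\le M$, the velocity may be any point of the segment joining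 the two vector fields of the adjacent zones (Filippov's convention); a $T$-periodic solution is a $T$-periodic function that is a solution on $[0,T]$. Define, for $x\in D$, $$f_1(x)=\int_0^TF_1(s,x)\,ds,$$ and, if $N\ge 2$, $$f_2(x)=\int_0^T\Big[D_xF_1(s,x)\int_0^sF_1(t,x)\,dt+F_2(s,x)\Big]ds,$$ $$f_2^*(x)=\sum_{j=1}^M\Big(F_1^{j-1}(\theta_j(x),x)-F_1^j(\theta_j(x),x)\Big)\,D_x\theta_j(x)\int_0^{\theta_j(x)}F_1(s,x)\,ds,$$ and put $\Delta_1=f_1$ and $\Delta_2=f_2+f_2^*$. (0) $\Delta_1$ and $\Delta_2$ are the first and second order Melnikov functions of (1): for every $x_0\in D$ and all sufficiently small $|\varepsilon|$, solutions of (1) on $[0,T]$ with $x(0)=x_0$ exist and all have the same displacement $\Delta(x_0,\varepsilon)=x(T)-x_0$; as $\varepsilon\to0$, $\Delta(x_0,\varepsilon)=\varepsilon\Delta_1(x_0)+O(\varepsilon^2)$, and if $N\ge2$ then $\Delta(x_0,\varepsilon)=\varepsilon\Delta_1(x_0)+\varepsilon^2\Delta_2(x_0)+O(\varepsilon^3)$.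 (i) If $a^*\in D$, $\Delta_1(a^*)=0$ and $\det(J\Delta_1(a^*))\neq0$, where $J\Delta_i$ denotes the Jacobian matrix of $\Delta_i$, then for $|\varepsilon|\ne0$ sufficiently small there is a unique $T$-periodic solution $x(t,\varepsilon)$ of (1) such that $x(0,\varepsilon)\to a^*$ as $\varepsilon\to0$. Uniqueness means that there is $\rho>0$ such that for all sufficiently small $|\varepsilon|\neq0$ the system has exactly one $T$-periodic solution with $|x(0)-a^*|<\rho$. (ii) If $N\ge2$, $\Delta_1\equiv0$ on $D$, $a^*\in D$, $\Delta_2(a^*)=0$ and $\det(J\Delta_2(a^*))\neq0$, then the conclusion of (i) holds for this $a^*$. -/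

import Mathlib

open Set Filter Topology MeasureTheory Asymptotics

/-- A `T`-periodic nonsmooth differential system
`ẋ = ∑_{i=1}^N ε^i F_i(t,x) + ε^(N+1) R(t,x,ε)` on an open set `D ⊆ ℝ^d`, of class `C^r` in each of
the `M + 1` zones `θ_j(x) < t < θ_{j+1}(x)`, `0 ≤ j ≤ M`, where
`0 = θ_0 < θ_1 < ⋯ < θ_M < θ_{M+1} = T`. In the zone `j` the system is given by the functions
`F_i^j = F i j` (`1 ≤ i ≤ N`) and `R^j = R j`, which are defined and `C^r` for all `t` and all
`x ∈ D`, and `T`-periodic in `t`. Values of `F i j` with `i = 0` or `i > N` are not used. -/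
structure NonsmoothSystem (d N M r : ℕ) where
  /-- the period -/
  T : ℝ
  T_pos : 0 < T
  /-- the phase domain -/
  D : Set (EuclideanSpace ℝ (Fin d))
  isOpen_D : IsOpen D
  /-- the range of the parameter is `(-ε₀, ε₀)` -/
  ε₀ : ℝ
  ε₀_pos : 0 < ε₀
  /-- the switching functions, including `θ_0 = 0` and `θ_{M+1} = T` -/
  θ : Fin (M + 2) → EuclideanSpace ℝ (Fin d) → ℝ
  θ_zero : ∀ x ∈ D, θ 0 x = 0
  θ_last : ∀ x ∈ D, θ (Fin.last (M + 1)) x = T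
  θ_strictMono : ∀ x ∈ D, StrictMono fun j => θ j x
  θ_smooth : ∀ j, ContDiffOn ℝ r (θ j) D
  /-- the coefficients `F_i^j` -/
  F : ℕ → Fin (M + 1) → ℝ → EuclideanSpace ℝ (Fin d) → EuclideanSpace ℝ (Fin d)
  F_smooth : ∀ i ∈ Finset.Icc 1 N, ∀ j,
    ContDiffOn ℝ r (fun p : ℝ × EuclideanSpace ℝ (Fin d) => F i j p.1 p.2) (univ ×ˢ D)
  F_periodic : ∀ i ∈ Finset.Icc 1 N, ∀ j, ∀ x ∈ D, Function.Periodic (fun t => F i j t x) T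
  /-- the remainders `R^j` -/
  R : Fin (M + 1) → ℝ → EuclideanSpace ℝ (Fin d) → ℝ → EuclideanSpace ℝ (Fin d)
  R_smooth : ∀ j,
    ContDiffOn ℝ r (fun p : ℝ × EuclideanSpace ℝ (Fin d) × ℝ => R j p.1 p.2.1 p.2.2)
      (univ ×ˢ D ×ˢ Ioo (-ε₀) ε₀)
  R_periodic : ∀ j, ∀ x ∈ D, ∀ ε ∈ Ioo (-ε₀) ε₀, Function.Periodic (fun t => R j t x ε) T

namespace NonsmoothSystem

variable {d N M r : ℕ} (S : NonsmoothSystem d N M r)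

/-- The vector field `F^j(t,x,ε) = ∑_{i=1}^N ε^i F_i^j(t,x) + ε^(N+1) R^j(t,x,ε)` of the zone `j`. -/
noncomputable def field (j : Fin (M + 1)) (t : ℝ) (x : EuclideanSpace ℝ (Fin d)) (ε : ℝ) :
    EuclideanSpace ℝ (Fin d) :=
  ∑ i ∈ Finset.Icc 1 N, ε ^ i • S.F i j t x + ε ^ (N + 1) • S.R j t x ε

/-- The set of velocities which the system allows at `(t,x)`, `0 ≤ t ≤ T`: the single vector
`F^j(t,x,ε)` inside the zone `j`, and Filippov's convention on the switching surface `t = θ_j(x)`,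
`1 ≤ j ≤ M`, namely the segment joining `F^{j-1}(t,x,ε)` and `F^j(t,x,ε)`. -/
def velocities (ε t : ℝ) (x : EuclideanSpace ℝ (Fin d)) : Set (EuclideanSpace ℝ (Fin d)) :=
  convexHull ℝ {v | ∃ j : Fin (M + 1),
    S.θ j.castSucc x ≤ t ∧ t ≤ S.θ j.succ x ∧ v = S.field j t x ε}

/-- `x` is a solution on `[0,T]` of the system with parameter `ε`: on `[0,T]` it takes its values
in `D`, it is absolutely continuous (a primitive of an integrable function `v`), and its velocity
`v` is allowed by the system at almost every time. -/
structure IsSolution (ε : ℝ) (x : ℝ → EuclideanSpace ℝ (Fin d)) : Prop where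
  mem : ∀ t ∈ Icc 0 S.T, x t ∈ S.D
  velocity : ∃ v : ℝ → EuclideanSpace ℝ (Fin d),
    IntervalIntegrable v volume 0 S.T ∧
    (∀ᵐ t : ℝ, t ∈ Icc 0 S.T → v t ∈ S.velocities ε t (x t)) ∧
    ∀ t ∈ Icc 0 S.T, x t = x 0 + ∫ s in (0 : ℝ)..t, v s

/-- `x` is a `T`-periodic solution. The system being `T`-periodic in `t`, a `T`-periodic function
solves it on `ℝ` as soon as it solves it on `[0,T]`. -/
structure IsPeriodicSolution (ε : ℝ) (x : ℝ → EuclideanSpace ℝ (Fin d)) : Prop where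
  periodic : Function.Periodic x S.T
  isSolution : S.IsSolution ε x

/-- `δ` is the value at `(x₀, ε)` of the displacement function: solutions on `[0,T]` which start at
`x₀` exist, and they all satisfy `x(T) - x₀ = δ`. -/
def HasDisplacement (x₀ : EuclideanSpace ℝ (Fin d)) (ε : ℝ) (δ : EuclideanSpace ℝ (Fin d)) :
    Prop :=
  (∃ x, S.IsSolution ε x ∧ x 0 = x₀) ∧ ∀ x, S.IsSolution ε x → x 0 = x₀ → x S.T - x₀ = δ

/-- The piecewise function `F_i(t,x)`, equal to `F_i^j(t,x)` for `θ_j(x) < t < θ_{j+1}(x)`. (On the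
switching surfaces, where its value is irrelevant, it is set to `0`.) -/
noncomputable def pwF (i : ℕ) (t : ℝ) (x : EuclideanSpace ℝ (Fin d)) : EuclideanSpace ℝ (Fin d) :=
  ∑ j : Fin (M + 1),
    (Ioo (S.θ j.castSucc x) (S.θ j.succ x)).indicator (fun s => S.F i j s x) t

/-- `f₁(x) = ∫_0^T F₁(s,x) ds`, the first order averaged function. -/
noncomputable def f₁ (x : EuclideanSpace ℝ (Fin d)) : EuclideanSpace ℝ (Fin d) :=
  ∫ s in (0 : ℝ)..S.T, S.pwF 1 s x

/-- `f₂(x) = ∫_0^T [D_xF₁(s,x) ∫_0^s F₁(t,x) dt + F₂(s,x)] ds`, the second order averaged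
function. -/
noncomputable def f₂ (x : EuclideanSpace ℝ (Fin d)) : EuclideanSpace ℝ (Fin d) :=
  ∫ s in (0 : ℝ)..S.T,
    (fderiv ℝ (fun z => S.pwF 1 s z) x (∫ t in (0 : ℝ)..s, S.pwF 1 t x) + S.pwF 2 s x)

/-- `f₂*(x) = ∑_{j=1}^M (D_xθ_j(x) ∫_0^{θ_j(x)} F₁(s,x) ds) (F₁^{j-1} - F₁^j)(θ_j(x),x)`. The index
`j` of this sum is `k + 1` with `k : Fin M`. -/
noncomputable def f₂star (x : EuclideanSpace ℝ (Fin d)) : EuclideanSpace ℝ (Fin d) :=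
  ∑ k : Fin M,
    (fderiv ℝ (S.θ k.succ.castSucc) x (∫ s in (0 : ℝ)..S.θ k.succ.castSucc x, S.pwF 1 s x)) •
      (S.F 1 k.castSucc (S.θ k.succ.castSucc x) x - S.F 1 k.succ (S.θ k.succ.castSucc x) x)

/-- The first order Melnikov function `Δ₁ = f₁`. -/
noncomputable def Δ₁ (x : EuclideanSpace ℝ (Fin d)) : EuclideanSpace ℝ (Fin d) := S.f₁ x

/-- The second order Melnikov function `Δ₂ = f₂ + f₂*`. -/
noncomputable def Δ₂ (x : EuclideanSpace ℝ (Fin d)) : EuclideanSpace ℝ (Fin d) :=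
  S.f₂ x + S.f₂star x

/-- For `|ε| ≠ 0` sufficiently small there is a unique `T`-periodic solution `x(·,ε)` such that
`x(0,ε) → a` as `ε → 0`. Uniqueness is that of a branch at `a`: for `|ε| ≠ 0` small, no other
`T`-periodic solution starts within a distance `ρ` of `a`, with `ρ` independent of `ε`. -/
def HasUniquePeriodicBranch (a : EuclideanSpace ℝ (Fin d)) : Prop :=
  ∃ ε₁ > 0, ∃ ρ > 0, ∃ x : ℝ → ℝ → EuclideanSpace ℝ (Fin d),
    (∀ ε : ℝ, ε ≠ 0 → |ε| < ε₁ →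
      S.IsPeriodicSolution ε (x ε) ∧ x ε 0 ∈ Metric.ball a ρ ∧
      ∀ y, S.IsPeriodicSolution ε y → y 0 ∈ Metric.ball a ρ → y = x ε) ∧
    Tendsto (fun ε => x ε 0) (𝓝[≠] 0) (𝓝 a)

end NonsmoothSystem

/-!
At `ε = 0` every solution rests, so for small `ε` a solution crosses the switching surfaces
`t = θ_k(x)` transversally: it meets each of them exactly once (`LocalData.exists_isOrbit`), and in
between it solves the smooth equation of one zone. If each piece of the solution is reparametrized
by `[0, 1]`, the pieces together with the crossing times are a fixed point `w = Φ((ξ, ε), w)` of an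
operator `piecesMap` on the Banach space `Pieces` of tuples of continuous curves and times, where
`ξ` is the initial value. After this reparametrization the times no longer appear as limits of
integration, so `Φ` is built from superposition operators and is as smooth as the data
(`contDiff_postcomp`). For `ε = 0` it does not depend on `w` at all; the implicit function theorem
therefore gives a unique and `C²` fixed point `w(ξ, ε)`, without any appeal to the smoothness of
flows. The field being `ε` times a `C²` field, the displacement is `ε Q(ξ, ε)` with `Q` of class
`C²` near `(x₀, 0)` (`NonsmoothSystem.exists_displacement_quotient`).

Differentiation of the fixed point equation at `ε = 0` gives `Q(ξ, 0) = Δ₁(ξ)` and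
`∂_ε Q(ξ, 0) = Δ₂(ξ)`. The derivative of the reparametrized time produces boundary terms by an
integration by parts in each zone (`hasDerivAt_zoneIntegral`); their sum over the zones is `f₂*`.
The Taylor expansion of `Q` in `ε` then yields the asymptotics of the displacement.

Periodic solutions correspond to zeros of `Q(·, ε)`. Both statements on periodic solutions are
instances of one fact (`exists_zero_branch`), applied to `G = ε Q` and to `G = Q`: if `G(x, 0) = 0`
and `a` is a simple zero of `x ↦ ∂_ε G(x, 0)`, then the maps `ε⁻¹ G(·, ε)` are, on a fixed ball
around `a`, Lipschitz close to an invertible linear map, so that each of them has exactly one zero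
there, which tends to `a`.
-/

/-! ### Superposition operators and fixed points depending on parameters -/

/-- Pointwise application of a continuous family of operators to a continuous curve. -/
noncomputable def pointwiseApply (K X F : Type) [TopologicalSpace K] [CompactSpace K]
    [NormedAddCommGroup X] [NormedSpace ℝ X] [NormedAddCommGroup F] [NormedSpace ℝ F] :
    C(K, X →L[ℝ] F) →L[ℝ] C(K, X) →L[ℝ] C(K, F) :=
  LinearMap.mkContinuous₂
    (LinearMap.mk₂ ℝ (fun (A : C(K, X →L[ℝ] F)) (z : C(K, X)) =>
        (⟨fun u => A u (z u), by fun_prop⟩ : C(K, F)))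
      (by intros; ext; simp) (by intros; ext; simp) (by intros; ext; simp) (by intros; ext; simp))
    1 (by
      intro A z
      rw [ContinuousMap.norm_le _ (by positivity)]
      intro u
      calc ‖A u (z u)‖ ≤ ‖A u‖ * ‖z u‖ := (A u).le_opNorm _
        _ ≤ 1 * ‖A‖ * ‖z‖ := by
          rw [one_mul]
          gcongr
          · exact A.norm_coe_le_norm u
          · exact z.norm_coe_le_norm u)

theorem pointwiseApply_apply {K X F : Type} [TopologicalSpace K] [CompactSpace K]
    [NormedAddCommGroup X] [NormedSpace ℝ X] [NormedAddCommGroup F] [NormedSpace ℝ F]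
    (A : C(K, X →L[ℝ] F)) (z : C(K, X)) (u : K) : pointwiseApply K X F A z u = A u (z u) := rfl

/-- The remainder is uniformly small along the curve because `f'` is uniformly continuous near the
compact range of `z`. -/
theorem hasFDerivAt_postcomp {K X F : Type} [TopologicalSpace K] [CompactSpace K]
    [NormedAddCommGroup X] [NormedSpace ℝ X] [NormedAddCommGroup F] [NormedSpace ℝ F]
    (f : C(X, F)) (f' : C(X, X →L[ℝ] F)) (hf : ∀ x, HasFDerivAt f (f' x) x) (z : C(K, X)) :
    HasFDerivAt (fun y : C(K, X) => f.comp y) (pointwiseApply K X F (f'.comp z)) z := by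
  rw [hasFDerivAt_iff_isLittleO_nhds_zero, isLittleO_iff]
  intro c hc
  have hK : IsCompact (range z) := isCompact_range z.continuous
  have hU := hK.uniformContinuousAt_of_continuousAt f' (fun x _ => f'.continuous.continuousAt)
    (Metric.dist_mem_uniformity hc)
  obtain ⟨δ, hδ, hδU⟩ := Metric.mem_uniformity_dist.1 hU
  filter_upwards [Metric.ball_mem_nhds (0 : C(K, X)) hδ] with h hh
  rw [mem_ball_zero_iff] at hh
  rw [ContinuousMap.norm_le _ (by positivity)]
  intro u
  have hu : ‖h u‖ ≤ ‖h‖ := h.norm_coe_le_norm u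
  have key := (convex_ball (z u) δ).norm_image_sub_le_of_norm_hasFDerivWithin_le'
    (f := f) (f' := f') (φ := f' (z u)) (C := c) (x := z u) (y := z u + h u)
    (fun x _ => (hf x).hasFDerivWithinAt) ?_ (Metric.mem_ball_self hδ) ?_
  · calc _ = ‖f (z u + h u) - f (z u) - f' (z u) (z u + h u - z u)‖ := by
          simp [pointwiseApply_apply]
      _ ≤ c * ‖z u + h u - z u‖ := key
      _ ≤ c * ‖h‖ := by simpa using mul_le_mul_of_nonneg_left hu hc.le
  · intro x hx
    have := hδU (a := z u) (b := x) (by rwa [dist_comm]) (mem_range_self u)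
    rw [← dist_eq_norm, dist_comm]
    exact le_of_lt this
  · simpa using hu.trans_lt hh

/-- The superposition operator of a `C^n` function is `C^n` on continuous curves. -/
theorem contDiff_postcomp {K X : Type} [TopologicalSpace K] [CompactSpace K]
    [NormedAddCommGroup X] [NormedSpace ℝ X] (n : ℕ) :
    ∀ {F : Type} [NormedAddCommGroup F] [NormedSpace ℝ F] (f : C(X, F)),
      ContDiff ℝ n f → ContDiff ℝ n (fun y : C(K, X) => f.comp y) := by
  induction n with
  | zero =>
    intro F _ _ f _
    exact contDiff_zero.2 (ContinuousMap.continuous_postcomp f)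
  | succ n ih =>
    intro F _ _ f hf
    push_cast at hf ⊢
    have hf' : ContDiff ℝ n (fderiv ℝ f) := (contDiff_succ_iff_fderiv.1 hf).2.2
    have hd : Differentiable ℝ f := (contDiff_succ_iff_fderiv.1 hf).1
    rw [contDiff_succ_iff_hasFDerivAt]
    refine ⟨_, ?_, hasFDerivAt_postcomp f ⟨fderiv ℝ f, hf'.continuous⟩
      fun x => (hd x).hasFDerivAt⟩
    exact (pointwiseApply K X F).contDiff.comp (ih ⟨fderiv ℝ f, hf'.continuous⟩ hf')

/-- A fixed point problem `w = Φ (p, w)` which at the base parameter does not depend on `w`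
to first order is solved near the base point by a unique function of `p`, as smooth as `Φ`. -/
theorem exists_contDiffAt_fixedPoint {P W : Type} [NormedAddCommGroup P] [NormedSpace ℝ P]
    [CompleteSpace P] [NormedAddCommGroup W] [NormedSpace ℝ W] [CompleteSpace W] {n : ℕ}
    (hn : n ≠ 0) (Φ : P × W → W) (p₀ : P) (w₀ : W) (hΦ : ContDiffAt ℝ n Φ (p₀, w₀))
    (hfix : ∀ w, Φ (p₀, w) = w₀) :
    ∃ φ : P → W, φ p₀ = w₀ ∧ ContDiffAt ℝ n φ p₀ ∧ (∀ᶠ p in 𝓝 p₀, Φ (p, φ p) = φ p) ∧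
      ∀ᶠ v in 𝓝 (p₀, w₀), Φ v = v.2 → v.2 = φ v.1 := by
  have hn' : (n : WithTop ℕ∞) ≠ 0 := by exact_mod_cast hn
  set f : P × W → W := fun v => v.2 - Φ v with hf
  have cdf : ContDiffAt ℝ n f (p₀, w₀) := contDiffAt_snd.sub hΦ
  have hd : DifferentiableAt ℝ Φ (p₀, w₀) := hΦ.differentiableAt hn'
  have h0 : fderiv ℝ Φ (p₀, w₀) ∘L .inr ℝ P W = 0 := by
    have h1 : HasFDerivAt (fun w => Φ (p₀, w)) (fderiv ℝ Φ (p₀, w₀) ∘L .inr ℝ P W) w₀ :=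
      HasFDerivAt.comp w₀ (f := fun w => (p₀, w)) hd.hasFDerivAt (hasFDerivAt_prodMk_right p₀ w₀)
    have h2 : HasFDerivAt (fun w => Φ (p₀, w)) (0 : W →L[ℝ] W) w₀ := by
      simp only [hfix]; exact hasFDerivAt_const _ _
    exact h1.unique h2
  have hinv : (fderiv ℝ f (p₀, w₀) ∘L .inr ℝ P W).IsInvertible := by
    have : fderiv ℝ f (p₀, w₀) = .snd ℝ P W - fderiv ℝ Φ (p₀, w₀) :=
      (hasFDerivAt_snd.sub hd.hasFDerivAt).fderiv
    rw [this, ContinuousLinearMap.sub_comp, h0, sub_zero]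
    exact ⟨.refl ℝ W, by ext; simp⟩
  have hf0 : f (p₀, w₀) = 0 := by simp [hf, hfix]
  refine ⟨cdf.implicitFunction hn' hinv, cdf.implicitFunction_apply_self hn' hinv,
    cdf.contDiffAt_implicitFunction hn' hinv, ?_, ?_⟩
  · filter_upwards [cdf.eventually_apply_implicitFunction hn' hinv] with p hp
    rw [hf0] at hp
    exact (sub_eq_zero.1 hp).symm
  · filter_upwards [cdf.eventually_apply_eq_iff_implicitFunction hn' hinv] with v hv hΦv
    exact (hv.1 (by rw [hf0]; simp [hf, hΦv])).symm

/-! ### Branches of zeros -/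

open scoped NNReal

/-- The difference `G (x, ε) - G (y, ε)` is close to `ε • H' (x - y, 0)`: the mean value inequality
in `ε` reduces this to the same estimate, without the factor `ε`, for `H = ∂_ε G`. -/
theorem norm_sub_sub_smul_le_of_hasDerivAt {E : Type} [NormedAddCommGroup E] [NormedSpace ℝ E]
    {G H : E × ℝ → E} {a : E} {H' : E × ℝ →L[ℝ] E} {δ : ℝ} {c : ℝ≥0}
    (hG : ∀ x ∈ Metric.ball a δ, ∀ e ∈ Metric.ball (0 : ℝ) δ,
      HasDerivAt (fun e => G (x, e)) (H (x, e)) e)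
    (hG0 : ∀ x ∈ Metric.ball a δ, G (x, 0) = 0)
    (hH : ApproximatesLinearOn H H' (Metric.ball a δ ×ˢ Metric.ball (0 : ℝ) δ) c)
    {x y : E} (hx : x ∈ Metric.ball a δ) (hy : y ∈ Metric.ball a δ) {ε : ℝ} (hε : |ε| < δ) :
    ‖G (x, ε) - G (y, ε) - ε • H' (x - y, 0)‖ ≤ c * ‖x - y‖ * |ε| := by
  have hδ : 0 < δ := (abs_nonneg ε).trans_lt hε
  have key := (convex_ball (0 : ℝ) δ).norm_image_sub_le_of_norm_hasDerivWithin_le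
    (f := fun e => G (x, e) - G (y, e) - e • H' (x - y, 0))
    (f' := fun e => H (x, e) - H (y, e) - H' (x - y, 0)) (C := c * ‖x - y‖) (x := 0) (y := ε)
    (fun e he => by
      have h := ((hG x hx e he).sub (hG y hy e he)).sub
        ((hasDerivAt_id e).smul_const (H' (x - y, 0)))
      rw [one_smul] at h
      exact h.hasDerivWithinAt)
    (fun e he => by
      have := hH (x, e) ⟨hx, he⟩ (y, e) ⟨hy, he⟩
      simpa [Prod.norm_def] using this)
    (Metric.mem_ball_self hδ) (by simpa using hε)
  simpa [hG0 x hx, hG0 y hy] using key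

/-- If `G (x, 0) = 0` near `a` and the `ε`-derivative `H` of `G` has at `(a, 0)` a zero which is
simple in the variable `x`, then for small `ε ≠ 0` the map `G (·, ε)` has a unique zero near `a`,
which tends to `a`. The maps `ε⁻¹ • G (·, ε)` are uniformly close to the invertible linear part
of `H (·, 0)`. -/
theorem exists_zero_branch {E : Type} [NormedAddCommGroup E] [NormedSpace ℝ E] [CompleteSpace E]
    {G H : E × ℝ → E} {a : E} {H' : E × ℝ →L[ℝ] E} (L : E ≃L[ℝ] E)
    (hG : ∀ᶠ v in 𝓝 (a, (0 : ℝ)), HasDerivAt (fun e => G (v.1, e)) (H v) v.2)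
    (hG0 : ∀ᶠ x in 𝓝 a, G (x, 0) = 0) (hH : HasStrictFDerivAt H H' (a, 0))
    (hL : ∀ x, H' (x, 0) = L x) (hHa : H (a, 0) = 0) :
    ∃ ρ₀ > 0, ∀ ρ > 0, ρ ≤ ρ₀ → ∃ ε₁ > 0, ∃ ξ : ℝ → E,
      (∀ ε : ℝ, ε ≠ 0 → |ε| < ε₁ → ξ ε ∈ Metric.ball a ρ ∧ G (ξ ε, ε) = 0 ∧
        ∀ y ∈ Metric.ball a ρ, G (y, ε) = 0 → y = ξ ε) ∧
      Tendsto ξ (𝓝[≠] 0) (𝓝 a) := by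
  -- the summand `1` keeps `N` positive when `E` is trivial
  set N : ℝ≥0 := ‖(L.symm : E →L[ℝ] E)‖₊ + 1 with hN
  have hN0 : 0 < N := by positivity
  have hNL : ∀ x : E, ‖L.symm x‖ ≤ N * ‖x‖ := fun x =>
    ((L.symm : E →L[ℝ] E).le_opNorm x).trans (by
      gcongr; simp [hN])
  -- half of the admissible constant `N⁻¹`: then `f ε` expands distances by `(2 * N)⁻¹` at least
  set c : ℝ≥0 := (2 * N)⁻¹ with hc
  have hc0 : 0 < c := by positivity
  have hNc : (N : ℝ) * c = 1 / 2 := by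
    have : (N : ℝ) ≠ 0 := by exact_mod_cast hN0.ne'
    rw [hc]; push_cast; field_simp
  obtain ⟨s, hs, hsH⟩ := hH.approximates_deriv_on_nhds (Or.inr hc0)
  obtain ⟨t, ht, htG⟩ := hG0.exists_mem
  obtain ⟨δ, hδ, hδs⟩ := Metric.mem_nhds_iff.1 (inter_mem (inter_mem hs hG)
    (prod_mem_nhds ht (univ_mem : (univ : Set ℝ) ∈ 𝓝 0)))
  rw [← ball_prod_same] at hδs
  have hGδ : ∀ x ∈ Metric.ball a δ, ∀ e ∈ Metric.ball (0 : ℝ) δ,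
      HasDerivAt (fun e => G (x, e)) (H (x, e)) e :=
    fun x hx e he => (hδs (mk_mem_prod hx he)).1.2
  have hG0δ : ∀ x ∈ Metric.ball a δ, G (x, 0) = 0 := fun x hx =>
    htG x (hδs (mk_mem_prod hx (Metric.mem_ball_self hδ))).2.1
  have hHδ := hsH.mono_set (fun v hv => (hδs hv).1.1 : Metric.ball a δ ×ˢ Metric.ball (0 : ℝ) δ ⊆ s)
  set f : ℝ → E → E := fun ε x => ε⁻¹ • G (x, ε) with hf
  have happ : ∀ ε : ℝ, ε ≠ 0 → |ε| < δ →
      ApproximatesLinearOn (f ε) (L : E →L[ℝ] E) (Metric.ball a δ) c := by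
    intro ε hε hεδ x hx y hy
    have := norm_sub_sub_smul_le_of_hasDerivAt hGδ hG0δ hHδ hx hy hεδ
    have h2 : f ε x - f ε y - L (x - y) = ε⁻¹ • (G (x, ε) - G (y, ε) - ε • H' (x - y, 0)) := by
      rw [smul_sub, smul_sub, smul_smul, inv_mul_cancel₀ hε, one_smul, hL]
    have hε' : 0 < |ε| := abs_pos.2 hε
    rw [ContinuousLinearEquiv.coe_coe, h2, norm_smul, norm_inv, Real.norm_eq_abs,
      inv_mul_le_iff₀ hε']
    linarith
  have hlim : Tendsto (fun ε => f ε a) (𝓝[≠] 0) (𝓝 0) := by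
    have h := hGδ a (Metric.mem_ball_self hδ) 0 (Metric.mem_ball_self hδ)
    rw [hHa, hasDerivAt_iff_tendsto_slope_zero] at h
    simpa [hf, hG0δ a (Metric.mem_ball_self hδ)] using h
  have hdist : ∀ ε : ℝ, ε ≠ 0 → |ε| < δ → ∀ x ∈ Metric.ball a δ, ∀ y ∈ Metric.ball a δ,
      ‖x - y‖ ≤ 2 * N * ‖f ε x - f ε y‖ := by
    intro ε hε hεδ x hx y hy
    have h1 := happ ε hε hεδ x hx y hy
    have h2 : ‖x - y‖ ≤ N * ‖L (x - y)‖ := by simpa using hNL (L (x - y))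
    have h3 : ‖L (x - y)‖ ≤ ‖f ε x - f ε y‖ + c * ‖x - y‖ := by
      have := norm_sub_le (f ε x - f ε y) (f ε x - f ε y - L (x - y))
      rw [sub_sub_cancel] at this
      exact this.trans (by gcongr; exact h1)
    have h4 : (N : ℝ) * ‖L (x - y)‖ ≤ N * ‖f ε x - f ε y‖ + N * c * ‖x - y‖ := by
      nlinarith [N.coe_nonneg]
    rw [hNc] at h4
    linarith
  let R : (L : E →L[ℝ] E).NonlinearRightInverse :=
    { toFun := L.symm, nnnorm := N, bound' := hNL, right_inv' := fun y => by simp }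
  refine ⟨δ / 2, by positivity, fun ρ hρ hρδ => ?_⟩
  have hρδ' : Metric.ball a ρ ⊆ Metric.ball a δ := Metric.ball_subset_ball (by linarith)
  have hsmall : ∀ᶠ ε in 𝓝[≠] (0 : ℝ), ‖f ε a‖ < c * (ρ / 2) := by
    have := hlim.norm
    rw [norm_zero] at this
    exact this.eventually_lt_const (by positivity)
  obtain ⟨η, hη, hηf⟩ := Metric.mem_nhdsWithin_iff.1 hsmall
  have hex : ∀ ε : ℝ, ∃ x, ε ≠ 0 → |ε| < min η δ → x ∈ Metric.ball a ρ ∧ G (x, ε) = 0 := by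
    intro ε
    by_cases hε : ε ≠ 0 ∧ |ε| < min η δ
    · obtain ⟨h0, h1⟩ := hε
      rw [lt_min_iff] at h1
      have hsub : Metric.closedBall a (ρ / 2) ⊆ Metric.ball a ρ :=
        Metric.closedBall_subset_ball (by linarith)
      have hsurj := (happ ε h0 h1.2).surjOn_closedBall_of_nonlinearRightInverse R
        (b := a) (ε := ρ / 2) (by positivity) (hsub.trans hρδ')
      have hR : ((R.nnnorm : ℝ)⁻¹ - c) = c := by
        have : (N : ℝ) ≠ 0 := by exact_mod_cast hN0.ne'
        simp only [R, hc]; push_cast; field_simp; norm_num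
      rw [hR] at hsurj
      have hmem : (0 : E) ∈ Metric.closedBall (f ε a) (c * (ρ / 2)) := by
        rw [mem_closedBall_iff_norm']
        simpa using (hηf ⟨by simpa using h1.1, h0⟩ : ‖f ε a‖ < c * (ρ / 2)).le
      obtain ⟨x, hx, hfx⟩ := hsurj hmem
      exact ⟨x, fun _ _ => ⟨hsub hx, (smul_eq_zero.1 hfx).resolve_left (inv_ne_zero h0)⟩⟩
    · exact ⟨a, fun h0 h1 => absurd ⟨h0, h1⟩ hε⟩
  choose ξ hξ using hex
  refine ⟨min η δ, by positivity, ξ, fun ε h0 h1 => ⟨(hξ ε h0 h1).1, (hξ ε h0 h1).2, ?_⟩, ?_⟩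
  · intro y hy hGy
    have h1' := (lt_min_iff.1 h1).2
    have := hdist ε h0 h1' y (hρδ' hy) (ξ ε) (hρδ' (hξ ε h0 h1).1)
    simp only [hf, hGy, (hξ ε h0 h1).2, smul_zero, sub_zero, norm_zero, mul_zero] at this
    exact sub_eq_zero.1 (norm_le_zero_iff.1 this)
  · rw [tendsto_iff_norm_sub_tendsto_zero]
    have hb : Tendsto (fun ε => 2 * (N : ℝ) * ‖f ε a‖) (𝓝[≠] 0) (𝓝 0) := by
      simpa using hlim.norm.const_mul (2 * (N : ℝ))
    refine squeeze_zero' (Eventually.of_forall fun _ => norm_nonneg _) ?_ hb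
    have hnear : ∀ᶠ ε in 𝓝[≠] (0 : ℝ), |ε| < min η δ := by
      filter_upwards [nhdsWithin_le_nhds (Metric.ball_mem_nhds (0 : ℝ)
        (show 0 < min η δ by positivity))] with ε hε
      simpa using hε
    filter_upwards [hnear, self_mem_nhdsWithin] with ε h1 h0
    have := hdist ε h0 (lt_min_iff.1 h1).2 (ξ ε) (hρδ' (hξ ε h0 h1).1) a (Metric.mem_ball_self hδ)
    have h2 : f ε (ξ ε) = 0 := by simp [hf, (hξ ε h0 h1).2]
    rwa [h2, zero_sub, norm_neg] at this

/-! ### Piecewise continuous functions on a partition of an interval -/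

section Piecewise

variable {E : Type} [NormedAddCommGroup E] {M : ℕ}

/-- The piecewise function equal to `g j` on the open interval `(τ j, τ (j + 1))`, and to `0` off
these intervals. -/
noncomputable def piecewiseOn (τ : Fin (M + 2) → ℝ) (g : Fin (M + 1) → ℝ → E) (s : ℝ) : E :=
  ∑ j : Fin (M + 1), (Ioo (τ j.castSucc) (τ j.succ)).indicator (g j) s

theorem eq_of_mem_zones {τ : Fin (M + 2) → ℝ} (hτ : StrictMono τ) {i j : Fin (M + 1)} {s : ℝ}
    (hi : s ∈ Icc (τ i.castSucc) (τ i.succ)) (hj : s ∈ Ioo (τ j.castSucc) (τ j.succ)) : i = j := by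
  rcases lt_trichotomy i j with h | h | h
  · have : τ i.succ ≤ τ j.castSucc := hτ.monotone (Fin.succ_le_castSucc_iff.2 h)
    linarith [hi.2, hj.1]
  · exact h
  · have : τ j.succ ≤ τ i.castSucc := hτ.monotone (Fin.succ_le_castSucc_iff.2 h)
    linarith [hi.1, hj.2]

theorem piecewiseOn_of_mem {τ : Fin (M + 2) → ℝ} (hτ : StrictMono τ) (g : Fin (M + 1) → ℝ → E)
    {j : Fin (M + 1)} {s : ℝ} (hs : s ∈ Ioo (τ j.castSucc) (τ j.succ)) :
    piecewiseOn τ g s = g j s := by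
  rw [piecewiseOn, Finset.sum_eq_single j, indicator_of_mem hs]
  · intro i _ hij
    exact indicator_of_notMem (fun hi => hij (eq_of_mem_zones hτ (Ioo_subset_Icc_self hi) hs)) _
  · simp

theorem exists_mem_zone (τ : Fin (M + 2) → ℝ) {s : ℝ}
    (hs : s ∈ Icc (τ 0) (τ (Fin.last (M + 1)))) :
    ∃ j : Fin (M + 1), s ∈ Icc (τ j.castSucc) (τ j.succ) := by
  by_contra! h
  have : ∀ k : Fin (M + 2), τ k ≤ s := by
    intro k
    induction k using Fin.induction with
    | zero => exact hs.1
    | succ j ih => exact le_of_not_ge fun hj => h j ⟨ih, hj⟩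
  have hlast : τ (Fin.last (M + 1)) = s := le_antisymm (this _) hs.2
  exact h (Fin.last M) ⟨this _, by rw [Fin.succ_last]; exact hlast.ge⟩

theorem exists_mem_zone_of_notMem_range (τ : Fin (M + 2) → ℝ) {s : ℝ}
    (hs : s ∈ Icc (τ 0) (τ (Fin.last (M + 1)))) (hsτ : s ∉ range τ) :
    ∃ j : Fin (M + 1), s ∈ Ioo (τ j.castSucc) (τ j.succ) := by
  obtain ⟨j, h1, h2⟩ := exists_mem_zone τ hs
  exact ⟨j, lt_of_le_of_ne h1 fun h => hsτ ⟨_, h⟩, lt_of_le_of_ne h2 fun h => hsτ ⟨_, h.symm⟩⟩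

theorem ae_notMem_range (τ : Fin (M + 2) → ℝ) : ∀ᵐ s : ℝ, s ∉ range τ :=
  (countable_range τ).ae_notMem volume

theorem intervalIntegrable_indicator_Ioo {f : ℝ → E} {a b c d : ℝ} (hab : a ≤ b)
    (hf : IntervalIntegrable f volume a b) :
    IntervalIntegrable ((Ioo a b).indicator f) volume c d := by
  have h : IntegrableOn f (Ioo a b) :=
    ((intervalIntegrable_iff_integrableOn_Ioc_of_le hab).1 hf).mono_set Ioo_subset_Ioc_self
  exact ((integrable_indicator_iff measurableSet_Ioo).2 h).intervalIntegrable

theorem intervalIntegrable_piecewiseOn {τ : Fin (M + 2) → ℝ} (hτ : Monotone τ)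
    {g : Fin (M + 1) → ℝ → E}
    (hg : ∀ j, IntervalIntegrable (g j) volume (τ j.castSucc) (τ j.succ)) (a b : ℝ) :
    IntervalIntegrable (piecewiseOn τ g) volume a b := by
  have : piecewiseOn τ g
      = ∑ j : Fin (M + 1), (Ioo (τ j.castSucc) (τ j.succ)).indicator (g j) := by
    ext s; simp [piecewiseOn]
  rw [this]
  exact IntervalIntegrable.sum _ fun j _ =>
    intervalIntegrable_indicator_Ioo (hτ (Fin.castSucc_lt_succ).le) (hg j)

theorem integral_indicator_Ioo_of_le [NormedSpace ℝ E] {f : ℝ → E} {a b c t : ℝ} (hca : c ≤ a) (hbt : b ≤ t)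
    (hab : a ≤ b) : ∫ s in c..t, (Ioo a b).indicator f s = ∫ s in a..b, f s := by
  rw [intervalIntegral.integral_of_le (hca.trans (hab.trans hbt)),
    intervalIntegral.integral_of_le hab, setIntegral_indicator measurableSet_Ioo,
    inter_eq_self_of_subset_right, integral_Ioc_eq_integral_Ioo]
  exact fun s hs => ⟨hca.trans_lt hs.1, hs.2.le.trans hbt⟩

theorem integral_indicator_Ioo_of_mem [NormedSpace ℝ E] {f : ℝ → E} {a b c t : ℝ} (hca : c ≤ a) (hat : a ≤ t)
    (htb : t ≤ b) : ∫ s in c..t, (Ioo a b).indicator f s = ∫ s in a..t, f s := by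
  rw [← integral_indicator_Ioo_of_le (f := f) hca le_rfl hat]
  refine intervalIntegral.integral_congr_ae ?_
  have : ∀ᵐ s : ℝ, s ≠ t := Measure.ae_ne volume t
  filter_upwards [this] with s hst hs
  rw [uIoc_of_le (hca.trans hat)] at hs
  have hlt : s < t := lt_of_le_of_ne hs.2 hst
  by_cases h : a < s
  · rw [indicator_of_mem (show s ∈ Ioo a b from ⟨h, hlt.trans_le htb⟩),
      indicator_of_mem (show s ∈ Ioo a t from ⟨h, hlt⟩)]
  · rw [indicator_of_notMem (fun hh => h hh.1), indicator_of_notMem (fun hh => h hh.1)]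

theorem integral_indicator_Ioo_of_ge [NormedSpace ℝ E] {f : ℝ → E} {a b c t : ℝ} (hct : c ≤ t) (hta : t ≤ a) :
    ∫ s in c..t, (Ioo a b).indicator f s = 0 := by
  rw [intervalIntegral.integral_of_le hct, setIntegral_indicator measurableSet_Ioo]
  have : Ioc c t ∩ Ioo a b = ∅ := by
    ext s; simp only [mem_inter_iff, mem_Ioc, mem_Ioo, mem_empty_iff_false, iff_false]
    intro h; linarith [h.1.2, h.2.1]
  simp [this]

theorem integral_piecewiseOn [NormedSpace ℝ E] {τ : Fin (M + 2) → ℝ} (hτ : Monotone τ)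
    {g : Fin (M + 1) → ℝ → E}
    (hg : ∀ j, IntervalIntegrable (g j) volume (τ j.castSucc) (τ j.succ)) (j : Fin (M + 1)) {t : ℝ}
    (ht : t ∈ Icc (τ j.castSucc) (τ j.succ)) :
    ∫ s in τ 0..t, piecewiseOn τ g s =
      (∑ i with Fin.castSucc i < j.castSucc, ∫ s in τ i.castSucc..τ i.succ, g i s) +
        ∫ s in τ j.castSucc..t, g j s := by
  have h0 : ∀ k, τ 0 ≤ τ k := fun k => hτ (Fin.zero_le k)
  simp only [piecewiseOn]
  rw [intervalIntegral.integral_finsetSum fun i _ =>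
    intervalIntegrable_indicator_Ioo (hτ (Fin.castSucc_lt_succ).le) (hg i),
    ← Finset.add_sum_erase _ _ (Finset.mem_univ j), add_comm,
    integral_indicator_Ioo_of_mem (h0 _) ht.1 ht.2]
  congr 1
  have hsub : (Finset.univ.filter fun i : Fin (M + 1) => i.castSucc < j.castSucc)
      ⊆ Finset.univ.erase j := by
    intro i hi
    simp only [Finset.mem_filter, Finset.mem_univ, true_and, Fin.castSucc_lt_castSucc_iff] at hi
    simp [hi.ne]
  rw [← Finset.sum_subset hsub]
  · refine Finset.sum_congr rfl fun i hi => ?_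
    simp only [Finset.mem_filter, Finset.mem_univ, true_and, Fin.castSucc_lt_castSucc_iff] at hi
    exact integral_indicator_Ioo_of_le (h0 _)
      ((hτ (Fin.succ_le_castSucc_iff.2 hi)).trans ht.1) (hτ (Fin.castSucc_lt_succ).le)
  · intro i hi hi'
    simp only [Finset.mem_filter, Finset.mem_univ, true_and, Fin.castSucc_lt_castSucc_iff,
      not_lt] at hi'
    have hji : j < i := lt_of_le_of_ne hi' (Finset.ne_of_mem_erase hi).symm
    exact integral_indicator_Ioo_of_ge ((h0 _).trans ht.1)
      (ht.2.trans (hτ (Fin.succ_le_castSucc_iff.2 hji)))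

theorem sum_castSucc_lt_succ (f : Fin (M + 1) → E) (j : Fin (M + 1)) :
    ∑ i with Fin.castSucc i < j.succ, f i
      = (∑ i with Fin.castSucc i < j.castSucc, f i) + f j := by
  have : (Finset.univ.filter fun i : Fin (M + 1) => i.castSucc < j.succ)
      = insert j (Finset.univ.filter fun i : Fin (M + 1) => i.castSucc < j.castSucc) := by
    ext i
    simp only [Finset.mem_filter, Finset.mem_univ, true_and, Finset.mem_insert,
      Fin.castSucc_lt_succ_iff, Fin.castSucc_lt_castSucc_iff]
    exact le_iff_eq_or_lt
  rw [this, Finset.sum_insert (by simp), add_comm]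

theorem integral_piecewiseOn_knot [NormedSpace ℝ E] {τ : Fin (M + 2) → ℝ} (hτ : Monotone τ)
    {g : Fin (M + 1) → ℝ → E}
    (hg : ∀ j, IntervalIntegrable (g j) volume (τ j.castSucc) (τ j.succ)) (k : Fin (M + 2)) :
    ∫ s in τ 0..τ k, piecewiseOn τ g s =
      ∑ i with Fin.castSucc i < k, ∫ s in τ i.castSucc..τ i.succ, g i s := by
  cases k using Fin.cases with
  | zero => simp
  | succ j =>
    rw [integral_piecewiseOn hτ hg j ⟨hτ (Fin.castSucc_lt_succ).le, le_rfl⟩, sum_castSucc_lt_succ]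

theorem sum_castSucc_lt_last (f : Fin (M + 1) → E) :
    ∑ i with Fin.castSucc i < Fin.last (M + 1), f i = ∑ i, f i := by
  simp [Fin.castSucc_lt_last]

theorem integral_rescale [NormedSpace ℝ E] (f : ℝ → E) (a b u : ℝ) :
    ∫ s in a..a + u * (b - a), f s = (b - a) • ∫ v in (0 : ℝ)..u, f (a + v * (b - a)) := by
  have := intervalIntegral.smul_integral_comp_add_mul (a := 0) (b := u) f (b - a) a
  simp only [mul_zero, add_zero] at this
  rw [mul_comm u, ← this]
  simp only [mul_comm]

end Piecewise

/-! ### The fixed point problem for the pieces of a solution -/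

section FixedPoint

variable {E : Type} [NormedAddCommGroup E] [NormedSpace ℝ E] {M : ℕ}

/-- The primitive `u ↦ ∫_0^u z` of a continuous curve on `[0, 1]`, as a bounded operator. -/
noncomputable def primitive (E : Type) [NormedAddCommGroup E] [NormedSpace ℝ E] :
    C(unitInterval, E) →L[ℝ] C(unitInterval, E) :=
  LinearMap.mkContinuous
    { toFun := fun z => ⟨fun u => ∫ v in (0 : ℝ)..u, IccExtend zero_le_one z v,
        (intervalIntegral.continuous_primitive
          (fun a b => (z.continuous.Icc_extend' (h := zero_le_one)).intervalIntegrable a b) 0).comp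
          continuous_subtype_val⟩
      map_add' := fun y z => by
        ext u
        exact intervalIntegral.integral_add
          ((y.continuous.Icc_extend' (h := zero_le_one)).intervalIntegrable _ _)
          ((z.continuous.Icc_extend' (h := zero_le_one)).intervalIntegrable _ _)
      map_smul' := fun c z => by
        ext u
        exact intervalIntegral.integral_smul c _ }
    1 (fun z => by
      rw [ContinuousMap.norm_le _ (by positivity)]
      intro u
      have := intervalIntegral.norm_integral_le_of_norm_le_const (a := 0) (b := (u : ℝ))
        (f := IccExtend zero_le_one z) (C := ‖z‖) (fun v _ => z.norm_coe_le_norm _)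
      refine this.trans ?_
      rw [sub_zero, abs_of_nonneg u.2.1, one_mul]
      exact mul_le_of_le_one_right (norm_nonneg _) u.2.2)

theorem primitive_apply (z : C(unitInterval, E)) (u : unitInterval) :
    primitive E z u = ∫ v in (0 : ℝ)..u, IccExtend zero_le_one z v := rfl

/-- The unknowns of the fixed point problem: the pieces of a solution in the `M + 1` zones, each
of them reparametrized by `[0, 1]`, and the `M + 2` times which bound the zones. -/
abbrev Pieces (E : Type) [NormedAddCommGroup E] (M : ℕ) : Type :=
  (Fin (M + 1) → C(unitInterval, E)) × (Fin (M + 2) → ℝ)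

/-- The graph `u ↦ (t, x, ε)` of the `j`-th piece, where `t` runs affinely through the `j`-th
time interval. -/
noncomputable def zoneGraph (E : Type) [NormedAddCommGroup E] [NormedSpace ℝ E] {M : ℕ}
    (j : Fin (M + 1)) : ℝ × Pieces E M →L[ℝ] C(unitInterval, ℝ × E × ℝ) :=
  LinearMap.mkContinuous
    { toFun := fun q => ⟨fun u => (q.2.2 j.castSucc + u * (q.2.2 j.succ - q.2.2 j.castSucc),
        q.2.1 j u, q.1), by fun_prop⟩
      map_add' := fun p q => by
        ext u
        · simp; ring
        · simp
        · simp
      map_smul' := fun c q => by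
        ext u
        · simp; ring
        · simp
        · simp }
    3 (fun q => by
      rw [ContinuousMap.norm_le _ (by positivity)]
      intro u
      have h1 : ‖q.1‖ ≤ ‖q‖ := norm_fst_le q
      have h2 : ‖q.2.1 j u‖ ≤ ‖q‖ := ((q.2.1 j).norm_coe_le_norm u).trans
        ((norm_le_pi_norm q.2.1 j).trans ((norm_fst_le q.2).trans (norm_snd_le q)))
      have h3 : ∀ k, ‖q.2.2 k‖ ≤ ‖q‖ := fun k =>
        (norm_le_pi_norm q.2.2 k).trans ((norm_snd_le q.2).trans (norm_snd_le q))
      have h4 : ‖(u : ℝ) * (q.2.2 j.succ - q.2.2 j.castSucc)‖ ≤ 2 * ‖q‖ := by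
        rw [norm_mul, Real.norm_of_nonneg u.2.1]
        have := norm_sub_le (q.2.2 j.succ) (q.2.2 j.castSucc)
        have h5 := mul_le_of_le_one_left (norm_nonneg (q.2.2 j.succ - q.2.2 j.castSucc)) u.2.2
        linarith [h3 j.succ, h3 j.castSucc]
      have h0 : 0 ≤ ‖q‖ := norm_nonneg q
      refine norm_prod_le_iff.2 ⟨?_, norm_prod_le_iff.2 ⟨?_, ?_⟩⟩
      · exact (norm_add_le _ _).trans (by linarith [h3 j.castSucc])
      · exact h2.trans (by linarith)
      · exact h1.trans (by linarith))

theorem zoneGraph_apply (j : Fin (M + 1)) (q : ℝ × Pieces E M) (u : unitInterval) :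
    zoneGraph E j q u = (q.2.2 j.castSucc + u * (q.2.2 j.succ - q.2.2 j.castSucc),
      q.2.1 j u, q.1) := rfl

variable (h : Fin (M + 1) → C(ℝ × E × ℝ, E)) (θ : Fin (M + 2) → E → ℝ)

/-- The integral of the field `h j` along the `j`-th piece, as a function of the upper end. -/
noncomputable def zoneIntegral (j : Fin (M + 1)) (q : ℝ × Pieces E M) : C(unitInterval, E) :=
  (q.2.2 j.succ - q.2.2 j.castSucc) • primitive E ((h j).comp (zoneGraph E j q))

/-- The sum of the integrals of the fields along all pieces before the time with index `k`. -/
noncomputable def increment (k : Fin (M + 2)) (q : ℝ × Pieces E M) : E :=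
  ∑ i with Fin.castSucc i < k, zoneIntegral h i q 1

/-- The operator whose fixed points are the solutions: integral equation in each zone and
crossing condition on each surface. -/
noncomputable def piecesMap (v : (E × ℝ) × Pieces E M) : Pieces E M :=
  (fun j => ContinuousMap.const unitInterval
      (v.1.1 + v.1.2 • increment h j.castSucc (v.1.2, v.2)) +
      v.1.2 • zoneIntegral h j (v.1.2, v.2),
    fun k => θ k (v.1.1 + v.1.2 • increment h k (v.1.2, v.2)))

/-- The fixed point of `piecesMap` at `ε = 0`. -/
noncomputable def restPieces (x : E) : Pieces E M :=
  (fun _ => ContinuousMap.const unitInterval x, fun k => θ k x)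

theorem piecesMap_zero (x : E) (w : Pieces E M) : piecesMap h θ ((x, 0), w) = restPieces θ x := by
  simp [piecesMap, restPieces]

variable {h θ}

theorem contDiff_zoneIntegral {n : ℕ} (hh : ∀ j, ContDiff ℝ n (h j)) (j : Fin (M + 1)) :
    ContDiff ℝ n (zoneIntegral h j) := by
  have h1 : ContDiff ℝ n fun q : ℝ × Pieces E M => (h j).comp (zoneGraph E j q) :=
    (contDiff_postcomp n (h j) (hh j)).comp (zoneGraph E j).contDiff
  have h2 : ContDiff ℝ n fun q : ℝ × Pieces E M => q.2.2 j.succ - q.2.2 j.castSucc := by fun_prop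
  exact h2.smul ((primitive E).contDiff.comp h1)

theorem contDiff_increment {n : ℕ} (hh : ∀ j, ContDiff ℝ n (h j)) (k : Fin (M + 2)) :
    ContDiff ℝ n (increment h k) :=
  ContDiff.sum fun i _ =>
    (ContinuousMap.evalCLM ℝ (1 : unitInterval) : C(unitInterval, E) →L[ℝ] E).contDiff.comp
      (contDiff_zoneIntegral hh i)

theorem contDiffAt_piecesMap {n : ℕ} (hh : ∀ j, ContDiff ℝ n (h j)) {x₀ : E}
    (hθ : ∀ k, ContDiffAt ℝ n (θ k) x₀) (w : Pieces E M) :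
    ContDiffAt ℝ n (piecesMap h θ) ((x₀, 0), w) := by
  have hA : ∀ k, ContDiff ℝ n fun v : (E × ℝ) × Pieces E M =>
      v.1.1 + v.1.2 • increment h k (v.1.2, v.2) := by
    intro k
    have := contDiff_increment hh k
    fun_prop
  have hB : ∀ j, ContDiff ℝ n fun v : (E × ℝ) × Pieces E M =>
      v.1.2 • zoneIntegral h j (v.1.2, v.2) := by
    intro j
    have := contDiff_zoneIntegral hh j
    fun_prop
  let C : E →L[ℝ] C(unitInterval, E) := ContinuousLinearMap.const ℝ unitInterval
  refine ContDiffAt.prodMk (contDiffAt_pi.2 fun j => ?_) (contDiffAt_pi.2 fun k => ?_)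
  · exact ((C.contDiff.comp (hA j.castSucc)).add (hB j)).contDiffAt
  · refine ContDiffAt.comp _ ?_ (hA k).contDiffAt
    simpa using hθ k

theorem exists_contDiffAt_pieces [CompleteSpace E] {n : ℕ} (hn : n ≠ 0)
    (hh : ∀ j, ContDiff ℝ n (h j)) {x₀ : E} (hθ : ∀ k, ContDiffAt ℝ n (θ k) x₀) :
    ∃ φ : E × ℝ → Pieces E M, φ (x₀, 0) = restPieces θ x₀ ∧ ContDiffAt ℝ n φ (x₀, 0) ∧
      (∀ᶠ p in 𝓝 (x₀, (0 : ℝ)), piecesMap h θ (p, φ p) = φ p) ∧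
      ∀ᶠ v in 𝓝 ((x₀, (0 : ℝ)), restPieces θ x₀), piecesMap h θ v = v.2 → v.2 = φ v.1 :=
  exists_contDiffAt_fixedPoint hn _ _ _ (contDiffAt_piecesMap hh hθ _) (piecesMap_zero h θ x₀)

end FixedPoint

/-! ### Expansion of the fixed point in the small parameter -/

section Expansion

variable {E : Type} [NormedAddCommGroup E] [NormedSpace ℝ E] {M : ℕ}
  {h : Fin (M + 1) → C(ℝ × E × ℝ, E)} {θ : Fin (M + 2) → E → ℝ}

theorem zoneIntegral_apply (j : Fin (M + 1)) (q : ℝ × Pieces E M) (u : unitInterval) :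
    zoneIntegral h j q u = (q.2.2 j.succ - q.2.2 j.castSucc) • ∫ v in (0 : ℝ)..u,
      h j (q.2.2 j.castSucc + v * (q.2.2 j.succ - q.2.2 j.castSucc),
        IccExtend zero_le_one (q.2.1 j) v, q.1) := by
  simp only [zoneIntegral, ContinuousMap.smul_apply, primitive_apply]
  congr 1
  refine intervalIntegral.integral_congr fun v hv => ?_
  rw [uIcc_of_le u.2.1] at hv
  have hv' : v ∈ Icc (0 : ℝ) 1 := ⟨hv.1, hv.2.trans u.2.2⟩
  simp only [IccExtend_of_mem zero_le_one _ hv', ContinuousMap.comp_apply, zoneGraph_apply]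

theorem zoneIntegral_rest (x : E) (j : Fin (M + 1)) (u : unitInterval) :
    zoneIntegral h j (0, restPieces θ x) u =
      ∫ s in θ j.castSucc x..θ j.castSucc x + u * (θ j.succ x - θ j.castSucc x),
        h j (s, x, 0) := by
  rw [zoneIntegral_apply, integral_rescale]
  rfl

theorem increment_rest {x : E} (hτ : StrictMono fun k => θ k x) (k : Fin (M + 2)) :
    increment h k (0, restPieces θ x) =
      ∫ s in θ 0 x..θ k x, piecewiseOn (fun k => θ k x) (fun j s => h j (s, x, 0)) s := by
  rw [integral_piecewiseOn_knot (τ := fun k => θ k x) hτ.monotone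
    fun j => Continuous.intervalIntegrable (by fun_prop) _ _]
  refine Finset.sum_congr rfl fun i _ => ?_
  rw [zoneIntegral_rest]
  simp

/-- To first order in `ε`, the pieces move along the integral of the unperturbed fields, and the
crossing times by the derivative of the switching functions in this direction. -/
theorem hasDerivAt_pieces {x : E} (hh : ∀ j, ContDiff ℝ 1 (h j))
    (hθ : ∀ k, DifferentiableAt ℝ (θ k) x) {w : ℝ → Pieces E M} (hw : DifferentiableAt ℝ w 0)
    (hfix : ∀ᶠ ε in 𝓝 0, piecesMap h θ ((x, ε), w ε) = w ε) :
    HasDerivAt w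
      (fun j => ContinuousMap.const unitInterval (increment h j.castSucc (0, restPieces θ x)) +
          zoneIntegral h j (0, restPieces θ x),
        fun k => fderiv ℝ (θ k) x (increment h k (0, restPieces θ x))) 0 := by
  have hw0 : w 0 = restPieces θ x := by rw [← hfix.self_of_nhds, piecesMap_zero]
  have hq : DifferentiableAt ℝ (fun ε => (ε, w ε)) 0 := differentiableAt_id.prodMk hw
  have hA : ∀ k, HasDerivAt (fun ε => x + ε • increment h k (ε, w ε))
      (increment h k (0, restPieces θ x)) 0 := by
    intro k
    have h1 : DifferentiableAt ℝ (fun ε => increment h k (ε, w ε)) 0 :=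
      ((contDiff_increment (n := 1) (by simpa using hh) k).differentiable (by simp) _).comp 0 hq
    have := ((hasDerivAt_id (0 : ℝ)).smul h1.hasDerivAt).const_add x
    simpa [hw0] using this
  have hB : ∀ j, HasDerivAt (fun ε => ε • zoneIntegral h j (ε, w ε))
      (zoneIntegral h j (0, restPieces θ x)) 0 := by
    intro j
    have h1 : DifferentiableAt ℝ (fun ε => zoneIntegral h j (ε, w ε)) 0 :=
      ((contDiff_zoneIntegral (n := 1) (by simpa using hh) j).differentiable (by simp) _).comp 0 hq
    refine ((hasDerivAt_id (0 : ℝ)).smul h1.hasDerivAt).congr_deriv ?_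
    simp [hw0]
  refine HasDerivAt.congr_of_eventuallyEq ?_ (hfix.mono fun _ h => h.symm)
  refine HasDerivAt.prodMk (hasDerivAt_pi.2 fun j => ?_) (hasDerivAt_pi.2 fun k => ?_)
  · exact ((ContinuousLinearMap.const ℝ unitInterval :
      E →L[ℝ] C(unitInterval, E)).hasFDerivAt.comp_hasDerivAt 0 (hA j.castSucc)).add (hB j)
  · refine HasFDerivAt.comp_hasDerivAt 0 ?_ (hA k)
    simpa using (hθ k).hasFDerivAt

/-- The `ε`-derivative of the integral over one zone. The moving ends of the time interval
contribute boundary terms, by an integration by parts. -/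
theorem hasDerivAt_zoneIntegral [CompleteSpace E] {x : E} (j : Fin (M + 1)) (hh : ContDiff ℝ 1 (h j))
    {w : ℝ → Pieces E M} (hw0 : w 0 = restPieces θ x) {z' : Fin (M + 1) → C(unitInterval, E)}
    {τ' : Fin (M + 2) → ℝ} (hw : HasDerivAt w (z', τ') 0) {y : ℝ → E} (hy : Continuous y)
    (hz' : ∀ u : unitInterval,
      z' j u = y (θ j.castSucc x + u * (θ j.succ x - θ j.castSucc x))) :
    HasDerivAt (fun ε => zoneIntegral h j (ε, w ε) 1)
      (τ' j.succ • h j (θ j.succ x, x, 0) - τ' j.castSucc • h j (θ j.castSucc x, x, 0) +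
        ∫ s in θ j.castSucc x..θ j.succ x, fderiv ℝ (h j) (s, x, 0) (0, y s, 1)) 0 := by
  have hq : HasDerivAt (fun ε => (ε, w ε)) ((1 : ℝ), (z', τ')) 0 := (hasDerivAt_id 0).prodMk hw
  have hd : Differentiable ℝ (h j) := hh.differentiable (by simp)
  have hf' : Continuous (fderiv ℝ (h j)) := hh.continuous_fderiv (by simp)
  have hg := (hasFDerivAt_postcomp (K := unitInterval) (h j) ⟨fderiv ℝ (h j), hf'⟩
    (fun v => (hd v).hasFDerivAt) (zoneGraph E j (0, w 0))).comp_hasDerivAt (0 : ℝ)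
    ((zoneGraph E j).hasFDerivAt.comp_hasDerivAt (0 : ℝ) hq)
  have hτj : ∀ k, HasDerivAt (fun ε => (w ε).2 k) (τ' k) 0 := fun k =>
    hasDerivAt_pi.1 ((hasFDerivAt_snd).comp_hasDerivAt (0 : ℝ) hw) k
  have hI := (ContinuousMap.evalCLM ℝ (1 : unitInterval) :
      C(unitInterval, E) →L[ℝ] E).hasFDerivAt.comp_hasDerivAt (0 : ℝ)
    (((hτj j.succ).sub (hτj j.castSucc)).smul
      ((primitive E).hasFDerivAt.comp_hasDerivAt (0 : ℝ) hg))
  refine HasDerivAt.congr_deriv hI ?_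
  set a := θ j.castSucc x with ha
  set b := θ j.succ x with hb
  have e1 : primitive E ((h j).comp (zoneGraph E j (0, w 0))) 1
      = ∫ u in (0 : ℝ)..1, h j (a + u * (b - a), x, 0) := by
    rw [primitive_apply]
    refine intervalIntegral.integral_congr fun v hv => ?_
    rw [uIcc_of_le (by simp)] at hv
    simp only [IccExtend_of_mem zero_le_one _ hv, ContinuousMap.comp_apply, zoneGraph_apply, hw0]
    rfl
  set α := τ' j.castSucc
  set β := τ' j.succ
  have e2 : primitive E (pointwiseApply unitInterval (ℝ × E × ℝ) E
        ((⟨fderiv ℝ (h j), hf'⟩ : C(ℝ × E × ℝ, _)).comp (zoneGraph E j (0, w 0)))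
          (zoneGraph E j (1, (z', τ')))) 1
      = ∫ u in (0 : ℝ)..1, fderiv ℝ (h j) (a + u * (b - a), x, 0)
          (α + u * (β - α), y (a + u * (b - a)), 1) := by
    rw [primitive_apply]
    refine intervalIntegral.integral_congr fun v hv => ?_
    rw [uIcc_of_le (by simp)] at hv
    simp only [IccExtend_of_mem zero_le_one _ hv, ContinuousMap.comp_apply, zoneGraph_apply, hw0,
      pointwiseApply_apply, hz']
    rfl
  have hsplit : ∀ u : ℝ, fderiv ℝ (h j) (a + u * (b - a), x, 0)
      (α + u * (β - α), y (a + u * (b - a)), 1)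
      = (α + u * (β - α)) • fderiv ℝ (h j) (a + u * (b - a), x, 0) (1, 0, 0)
        + fderiv ℝ (h j) (a + u * (b - a), x, 0) (0, y (a + u * (b - a)), 1) := by
    intro u
    rw [← map_smul, ← map_add]
    simp
  -- the part with the `t`-derivative is, up to a multiple of `h j`, a total derivative in `u`
  have hparts : ∀ u : ℝ, HasDerivAt
      (fun u => (α + u * (β - α)) • h j (a + u * (b - a), x, 0))
      ((α + u * (β - α)) • (b - a) • fderiv ℝ (h j) (a + u * (b - a), x, 0) (1, 0, 0)
        + (β - α) • h j (a + u * (b - a), x, 0)) u := by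
    intro u
    have h1 : HasDerivAt (fun u : ℝ => α + u * (β - α)) (β - α) u := by
      simpa using ((hasDerivAt_id u).mul_const (β - α)).const_add α
    have h2 : HasDerivAt (fun u : ℝ => ((a + u * (b - a), x, 0) : ℝ × E × ℝ)) (b - a, 0, 0) u :=
      (by simpa using ((hasDerivAt_id u).mul_const (b - a)).const_add a :
        HasDerivAt (fun u : ℝ => a + u * (b - a)) (b - a) u).prodMk (hasDerivAt_const u (x, (0 : ℝ)))
    have h3 := (hd (a + u * (b - a), x, 0)).hasFDerivAt.comp_hasDerivAt u h2
    have h4 := h1.smul h3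
    have h5 : ((b - a, 0, 0) : ℝ × E × ℝ) = (b - a) • (1, 0, 0) := by simp
    rw [h5, map_smul] at h4
    exact h4
  have c1 : Continuous fun u : ℝ => (α + u * (β - α)) • (b - a) •
      fderiv ℝ (h j) (a + u * (b - a), x, 0) (1, 0, 0) := by fun_prop
  have c2 : Continuous fun u : ℝ => (β - α) • h j (a + u * (b - a), x, 0) := by fun_prop
  have c3 : Continuous fun u : ℝ =>
      fderiv ℝ (h j) (a + u * (b - a), x, 0) (0, y (a + u * (b - a)), 1) := by fun_prop
  have c4 : Continuous fun u : ℝ => (α + u * (β - α)) •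
      fderiv ℝ (h j) (a + u * (b - a), x, 0) (1, 0, 0) := by fun_prop
  have hFTC := intervalIntegral.integral_eq_sub_of_hasDerivAt (a := 0) (b := 1)
    (fun u _ => hparts u) ((c1.add c2).intervalIntegrable _ _)
  rw [intervalIntegral.integral_add (c1.intervalIntegrable _ _) (c2.intervalIntegrable _ _)] at hFTC
  have hresc := integral_rescale (fun s => fderiv ℝ (h j) (s, x, 0) (0, y s, 1)) a b 1
  have hends : (w 0).2 j.succ - (w 0).2 j.castSucc = b - a := by rw [hw0]; rfl
  have hab : a + 1 * (b - a) = b := by ring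
  have hαβ : α + 1 * (β - α) = β := by ring
  rw [hab] at hresc hFTC
  rw [hαβ] at hFTC
  simp only [zero_mul, add_zero] at hFTC
  rw [hresc, ← hFTC]
  change ((w 0).2 j.succ - (w 0).2 j.castSucc) • primitive E _ 1 +
    (β - α) • primitive E ((h j).comp (zoneGraph E j (0, w 0))) 1 = _
  rw [hends, e1, e2]
  simp_rw [hsplit, smul_comm _ (b - a)]
  rw [intervalIntegral.integral_add (c4.intervalIntegrable _ _) (c3.intervalIntegrable _ _),
    intervalIntegral.integral_smul, intervalIntegral.integral_smul, smul_add]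
  abel

/-- Summation by parts over the zones: the boundary terms of adjacent zones combine into jumps. -/
theorem sum_succ_sub_castSucc (f g : Fin (M + 1) → ℝ → E) (t c : Fin (M + 2) → ℝ)
    (h0 : c 0 = 0) (hlast : c (Fin.last (M + 1)) = 0) :
    ∑ j : Fin (M + 1), (c j.succ • f j (t j.succ) - c j.castSucc • g j (t j.castSucc)) =
      ∑ k : Fin M, c k.succ.castSucc •
        (f k.castSucc (t k.succ.castSucc) - g k.succ (t k.succ.castSucc)) := by
  rw [Finset.sum_sub_distrib, Fin.sum_univ_castSucc, Fin.sum_univ_succ (n := M) (f := fun j =>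
    c j.castSucc • g j (t j.castSucc))]
  simp [h0, hlast, smul_sub, Finset.sum_sub_distrib]

/-- The first two coefficients of the expansion in `ε` of the displacement divided by `ε`: at
order one there are the average of the derivatives and the contributions of the moving switching
times. -/
theorem hasDerivAt_increment_last [CompleteSpace E] {x : E} (hh : ∀ j, ContDiff ℝ 1 (h j))
    (hτ : StrictMono fun k => θ k x) (hθ : ∀ k, DifferentiableAt ℝ (θ k) x)
    (hθ0 : fderiv ℝ (θ 0) x = 0) (hθlast : fderiv ℝ (θ (Fin.last (M + 1))) x = 0)
    {w : ℝ → Pieces E M} (hw : DifferentiableAt ℝ w 0)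
    (hfix : ∀ᶠ ε in 𝓝 0, piecesMap h θ ((x, ε), w ε) = w ε) {y : ℝ → E}
    (hy : ∀ t, y t = ∫ s in θ 0 x..t,
      piecewiseOn (fun k => θ k x) (fun j s => h j (s, x, 0)) s) :
    HasDerivAt (fun ε => increment h (Fin.last (M + 1)) (ε, w ε))
      (∑ j : Fin (M + 1), (∫ s in θ j.castSucc x..θ j.succ x,
          fderiv ℝ (h j) (s, x, 0) (0, y s, 1)) +
        ∑ k : Fin M, fderiv ℝ (θ k.succ.castSucc) x (y (θ k.succ.castSucc x)) •
          (h k.castSucc (θ k.succ.castSucc x, x, 0) - h k.succ (θ k.succ.castSucc x, x, 0))) 0 := by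
  have hw0 : w 0 = restPieces θ x := by rw [← hfix.self_of_nhds, piecesMap_zero]
  have hint : ∀ j : Fin (M + 1), IntervalIntegrable (fun s => h j (s, x, 0)) volume
      (θ j.castSucc x) (θ j.succ x) := fun j => Continuous.intervalIntegrable (by fun_prop) _ _
  have hyc : Continuous y := by
    have := intervalIntegral.continuous_primitive
      (intervalIntegrable_piecewiseOn (τ := fun k => θ k x) hτ.monotone hint) (θ 0 x)
    rwa [← funext hy] at this
  have hd := hasDerivAt_pieces hh hθ hw hfix
  have hinc : ∀ k, increment h k (0, restPieces θ x) = y (θ k x) := fun k => by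
    rw [increment_rest hτ, hy]
  have hz : ∀ (j : Fin (M + 1)) (u : unitInterval),
      (ContinuousMap.const unitInterval (increment h j.castSucc (0, restPieces θ x)) +
        zoneIntegral h j (0, restPieces θ x)) u =
      y (θ j.castSucc x + u * (θ j.succ x - θ j.castSucc x)) := by
    intro j u
    have hlt : θ j.castSucc x < θ j.succ x := hτ Fin.castSucc_lt_succ
    rw [hy, integral_piecewiseOn (τ := fun k => θ k x) hτ.monotone hint j
      ⟨by nlinarith [u.2.1], by nlinarith [u.2.2]⟩, ← integral_piecewiseOn_knot
        (τ := fun k => θ k x) hτ.monotone hint]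
    simp [increment_rest hτ, zoneIntegral_rest]
  have hsum := HasDerivAt.fun_sum (u := (Finset.univ : Finset (Fin (M + 1)))) fun j _ =>
    hasDerivAt_zoneIntegral j (hh j) hw0 hd hyc (hz j)
  have hfun : (fun ε => increment h (Fin.last (M + 1)) (ε, w ε))
      = fun ε => ∑ j : Fin (M + 1), zoneIntegral h j (ε, w ε) 1 := by
    ext ε; exact sum_castSucc_lt_last _
  rw [hfun]
  refine hsum.congr_deriv ?_
  rw [Finset.sum_add_distrib, add_comm]
  congr 1
  rw [sum_succ_sub_castSucc (fun j s => h j (s, x, 0)) (fun j s => h j (s, x, 0))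
    (fun k => θ k x) (fun k => fderiv ℝ (θ k) x (increment h k (0, restPieces θ x)))
    (by simp [hθ0]) (by simp [hθlast])]
  simp [hinc]

end Expansion

/-! ### Slow curves, crossing times, and fixed points as curves -/

section Curves

variable {E : Type} [NormedAddCommGroup E] [NormedSpace ℝ E]

theorem continuousOn_of_eq_add_integral {x v : ℝ → E} {T : ℝ} (hT : 0 ≤ T)
    (hv : IntervalIntegrable v volume 0 T)
    (hx : ∀ t ∈ Icc 0 T, x t = x 0 + ∫ s in (0 : ℝ)..t, v s) : ContinuousOn x (Icc 0 T) := by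
  have h := intervalIntegral.continuousOn_primitive_interval' (a := 0) hv left_mem_uIcc
  rw [uIcc_of_le hT] at h
  exact (continuousOn_const.add h).congr hx

theorem norm_sub_le_of_ae_norm_le {x v : ℝ → E} {T c : ℝ}
    (hv : IntervalIntegrable v volume 0 T)
    (hx : ∀ t ∈ Icc 0 T, x t = x 0 + ∫ s in (0 : ℝ)..t, v s) {s t : ℝ} (hs : 0 ≤ s) (hst : s ≤ t)
    (ht : t ≤ T) (hc : ∀ᵐ r, r ∈ Ioc s t → ‖v r‖ ≤ c) : ‖x t - x s‖ ≤ c * (t - s) := by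
  have hT : 0 ≤ T := hs.trans (hst.trans ht)
  have hsub : ∀ r ∈ Icc 0 T, IntervalIntegrable v volume 0 r := fun r hr =>
    hv.mono_set (by rw [uIcc_of_le hr.1, uIcc_of_le hT]; exact Icc_subset_Icc_right hr.2)
  have hs' : s ∈ Icc 0 T := ⟨hs, hst.trans ht⟩
  have ht' : t ∈ Icc 0 T := ⟨hs.trans hst, ht⟩
  rw [hx t ht', hx s hs', add_sub_add_left_eq_sub,
    intervalIntegral.integral_interval_sub_left (hsub t ht') (hsub s hs')]
  have := intervalIntegral.norm_integral_le_of_norm_le_const_ae (a := s) (b := t) (f := v) (C := c)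
    (by simpa [uIoc_of_le hst] using hc)
  rwa [abs_of_nonneg (sub_nonneg.2 hst)] at this

/-- A curve whose speed is small as long as it stays in a ball does not leave this ball. -/
theorem mem_ball_of_ae_norm_le {x v : ℝ → E} {T c δ : ℝ} {x₀ : E}
    (hc0 : 0 ≤ c) (hv : IntervalIntegrable v volume 0 T)
    (hx : ∀ t ∈ Icc 0 T, x t = x 0 + ∫ s in (0 : ℝ)..t, v s)
    (hc : ∀ᵐ t, t ∈ Icc 0 T → x t ∈ Metric.closedBall x₀ δ → ‖v t‖ ≤ c)
    (hδ : ‖x 0 - x₀‖ + c * T < δ) {t : ℝ} (ht : t ∈ Icc 0 T) : x t ∈ Metric.ball x₀ δ := by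
  have hT : 0 ≤ T := ht.1.trans ht.2
  have hcont := continuousOn_of_eq_add_integral hT hv hx
  by_contra hout
  -- the first exit time
  set A : Set ℝ := Icc 0 T ∩ {r | δ ≤ ‖x r - x₀‖} with hA
  have hAne : A.Nonempty := ⟨t, ht, by simpa [dist_eq_norm] using hout⟩
  have hAc : IsClosed A := by
    have : A = Icc 0 T ∩ (fun r => ‖x r - x₀‖) ⁻¹' Ici δ := rfl
    rw [this]
    exact (hcont.sub continuousOn_const).norm.preimage_isClosed_of_isClosed isClosed_Icc isClosed_Ici
  have hAb : BddBelow A := ⟨0, fun r hr => hr.1.1⟩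
  have hmem := hAc.csInf_mem hAne hAb
  set r := sInf A
  have hlt : ∀ s ∈ Icc 0 T, s < r → x s ∈ Metric.closedBall x₀ δ := by
    intro s hs hsr
    rw [mem_closedBall_iff_norm]
    by_contra hcon
    exact absurd (csInf_le hAb ⟨hs, (not_le.1 hcon).le⟩) (not_le.2 hsr)
  have hbound := norm_sub_le_of_ae_norm_le hv hx le_rfl hmem.1.1 hmem.1.2 (c := c) (by
    filter_upwards [hc, Measure.ae_ne volume r] with s hs hsr hsm
    exact hs ⟨hsm.1.le, hsm.2.trans hmem.1.2⟩
      (hlt s ⟨hsm.1.le, hsm.2.trans hmem.1.2⟩ (lt_of_le_of_ne hsm.2 hsr)))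
  have h1 : δ ≤ ‖x r - x₀‖ := hmem.2
  have h2 : ‖x r - x₀‖ ≤ ‖x r - x 0‖ + ‖x 0 - x₀‖ := norm_sub_le_norm_sub_add_norm_sub _ _ _
  have h3 : c * (r - 0) ≤ c * T := by rw [sub_zero]; gcongr; exact hmem.1.2
  linarith

/-- If `g` is Lipschitz with a constant less than `1`, then `t - g t` changes sign only once. -/
theorem crossing_order {g : ℝ → ℝ} {T κ τ : ℝ} (hκ : κ < 1)
    (hg : ∀ s ∈ Icc 0 T, ∀ t ∈ Icc 0 T, s ≤ t → |g t - g s| ≤ κ * (t - s))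
    (hτ : τ ∈ Icc 0 T) (hgτ : g τ = τ) {t : ℝ} (ht : t ∈ Icc 0 T) :
    (t < τ → t < g t) ∧ (τ < t → g t < t) := by
  constructor
  · intro h
    have := (abs_le.1 (hg t ht τ hτ h.le)).2
    nlinarith
  · intro h
    have := (abs_le.1 (hg τ hτ t ht h.le)).2
    nlinarith

theorem exists_crossing {g : ℝ → ℝ} {T : ℝ} (hT : 0 ≤ T) (hg : ContinuousOn g (Icc 0 T))
    (hmap : ∀ t ∈ Icc 0 T, g t ∈ Icc 0 T) : ∃ τ ∈ Icc 0 T, g τ = τ := by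
  obtain ⟨τ, hτ, h⟩ := intermediate_value_Icc hT (f := fun t => t - g t)
    (continuousOn_id.sub hg) (show (0 : ℝ) ∈ Icc _ _ from
      ⟨by linarith [(hmap 0 ⟨le_rfl, hT⟩).1], by linarith [(hmap T ⟨hT, le_rfl⟩).2]⟩)
  exact ⟨τ, hτ, by linarith [show τ - g τ = 0 from h]⟩

end Curves

section Correspondence

variable {E : Type} [NormedAddCommGroup E] [NormedSpace ℝ E] {M : ℕ}
  {h : Fin (M + 1) → C(ℝ × E × ℝ, E)} {θ : Fin (M + 2) → E → ℝ}

theorem affine_mem_Icc {a b : ℝ} (hab : a ≤ b) (u : unitInterval) :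
    a + u * (b - a) ∈ Icc a b :=
  ⟨by nlinarith [u.2.1], by nlinarith [u.2.2]⟩

theorem exists_affine_eq {a b t : ℝ} (hab : a < b) (ht : t ∈ Icc a b) :
    ∃ u : unitInterval, a + u * (b - a) = t := by
  have h : 0 < b - a := sub_pos.2 hab
  refine ⟨⟨(t - a) / (b - a), div_nonneg (by linarith [ht.1]) h.le,
    (div_le_one h).2 (by linarith [ht.2])⟩, ?_⟩
  simp only
  field_simp
  ring

theorem zoneIntegral_eq {z : Fin (M + 1) → C(unitInterval, E)} {τ : Fin (M + 2) → ℝ} {ε : ℝ}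
    (j : Fin (M + 1)) {X : ℝ → E}
    (hX : ∀ u : unitInterval, X (τ j.castSucc + u * (τ j.succ - τ j.castSucc)) = z j u)
    (u : unitInterval) :
    zoneIntegral h j (ε, (z, τ)) u =
      ∫ s in τ j.castSucc..τ j.castSucc + u * (τ j.succ - τ j.castSucc), h j (s, X s, ε) := by
  rw [zoneIntegral_apply, integral_rescale]
  congr 1
  refine intervalIntegral.integral_congr fun v hv => ?_
  rw [uIcc_of_le u.2.1] at hv
  have hv' : v ∈ Icc (0 : ℝ) 1 := ⟨hv.1, hv.2.trans u.2.2⟩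
  simp only [IccExtend_of_mem zero_le_one _ hv']
  rw [← hX ⟨v, hv'⟩]

variable {z : Fin (M + 1) → C(unitInterval, E)} {τ : Fin (M + 2) → ℝ} {ε : ℝ}
  {X : Fin (M + 1) → ℝ → E}

theorem intervalIntegrable_zoneField (hτ : StrictMono τ)
    (hXc : ∀ j, ContinuousOn (X j) (Icc (τ j.castSucc) (τ j.succ))) (j : Fin (M + 1)) :
    IntervalIntegrable (fun s => ε • h j (s, X j s, ε)) volume (τ j.castSucc) (τ j.succ) := by
  refine ContinuousOn.intervalIntegrable ?_
  rw [uIcc_of_le (hτ Fin.castSucc_lt_succ).le]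
  exact ((h j).continuous.comp_continuousOn
    (continuousOn_id.prodMk ((hXc j).prodMk continuousOn_const))).const_smul ε

theorem smul_increment_eq (hτ : StrictMono τ)
    (hXc : ∀ j, ContinuousOn (X j) (Icc (τ j.castSucc) (τ j.succ)))
    (hX : ∀ j, ∀ u : unitInterval, X j (τ j.castSucc + u * (τ j.succ - τ j.castSucc)) = z j u)
    (k : Fin (M + 2)) :
    ε • increment h k (ε, (z, τ)) =
      ∫ s in τ 0..τ k, piecewiseOn τ (fun j s => ε • h j (s, X j s, ε)) s := by
  rw [integral_piecewiseOn_knot hτ.monotone (intervalIntegrable_zoneField hτ hXc), increment,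
    Finset.smul_sum]
  refine Finset.sum_congr rfl fun i _ => ?_
  rw [zoneIntegral_eq i (hX i), intervalIntegral.integral_smul]
  simp

theorem smul_increment_add_zoneIntegral_eq (hτ : StrictMono τ)
    (hXc : ∀ j, ContinuousOn (X j) (Icc (τ j.castSucc) (τ j.succ)))
    (hX : ∀ j, ∀ u : unitInterval, X j (τ j.castSucc + u * (τ j.succ - τ j.castSucc)) = z j u)
    (j : Fin (M + 1)) (u : unitInterval) :
    ε • increment h j.castSucc (ε, (z, τ)) + ε • zoneIntegral h j (ε, (z, τ)) u =
      ∫ s in τ 0..τ j.castSucc + u * (τ j.succ - τ j.castSucc),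
        piecewiseOn τ (fun j s => ε • h j (s, X j s, ε)) s := by
  have hI := intervalIntegrable_zoneField (h := h) (ε := ε) hτ hXc
  rw [integral_piecewiseOn hτ.monotone hI j (affine_mem_Icc (hτ Fin.castSucc_lt_succ).le u),
    smul_increment_eq hτ hXc hX, zoneIntegral_eq j (hX j), intervalIntegral.integral_smul,
    integral_piecewiseOn_knot hτ.monotone hI]

/-- The fixed points of `piecesMap` are the curves with velocity `ε • h j` in the `j`-th zone which
meet the switching surfaces at the times `τ k`. -/
theorem piecesMap_eq_iff (hτ : StrictMono τ)
    (hXc : ∀ j, ContinuousOn (X j) (Icc (τ j.castSucc) (τ j.succ)))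
    (hX : ∀ j, ∀ u : unitInterval, X j (τ j.castSucc + u * (τ j.succ - τ j.castSucc)) = z j u)
    {ξ : E} {x : ℝ → E}
    (hx : ∀ t ∈ Icc (τ 0) (τ (Fin.last (M + 1))), x t = ξ + ∫ s in τ 0..t,
      piecewiseOn τ (fun j s => ε • h j (s, X j s, ε)) s) :
    piecesMap h θ ((ξ, ε), (z, τ)) = (z, τ) ↔
      (∀ j, ∀ u : unitInterval, x (τ j.castSucc + u * (τ j.succ - τ j.castSucc)) = z j u) ∧
        ∀ k, θ k (x (τ k)) = τ k := by
  have hmem : ∀ k, τ k ∈ Icc (τ 0) (τ (Fin.last (M + 1))) := fun k =>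
    ⟨hτ.monotone (Fin.zero_le k), hτ.monotone (Fin.le_last k)⟩
  have hmem' : ∀ (j : Fin (M + 1)) (u : unitInterval), τ j.castSucc + u * (τ j.succ - τ j.castSucc)
      ∈ Icc (τ 0) (τ (Fin.last (M + 1))) := fun j u =>
    Icc_subset_Icc (hmem _).1 (hmem _).2 (affine_mem_Icc (hτ Fin.castSucc_lt_succ).le u)
  rw [Prod.ext_iff]
  refine and_congr ?_ ?_
  · rw [funext_iff]
    refine forall_congr' fun j => ?_
    rw [ContinuousMap.ext_iff]
    refine forall_congr' fun u => ?_
    rw [hx _ (hmem' j u), ← smul_increment_add_zoneIntegral_eq hτ hXc hX j u, ← add_assoc]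
    rfl
  · rw [funext_iff]
    refine forall_congr' fun k => ?_
    rw [hx _ (hmem k), ← smul_increment_eq hτ hXc hX k]
    rfl

end Correspondence

/-! ### Local data of a nonsmooth system -/

/-- Cut-off: a smooth function of `(t, y)` given for `y` in an open set agrees near `y₀`, for all
`t`, with a globally defined one. -/
theorem exists_contDiff_eq_of_contDiffOn {Y F : Type} [NormedAddCommGroup Y] [NormedSpace ℝ Y]
    [FiniteDimensional ℝ Y] [NormedAddCommGroup F] [NormedSpace ℝ F] {n : ℕ} {U : Set Y}
    (hU : IsOpen U) {f : ℝ × Y → F} (hf : ContDiffOn ℝ n f (univ ×ˢ U)) {y₀ : Y} (hy : y₀ ∈ U) :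
    ∃ g : C(ℝ × Y, F), ContDiff ℝ n g ∧ ∀ᶠ y in 𝓝 y₀, ∀ t, g (t, y) = f (t, y) := by
  obtain ⟨δ, hδ, hδU⟩ := Metric.nhds_basis_closedBall.mem_iff.1 (hU.mem_nhds hy)
  let b : ContDiffBump y₀ := ⟨δ / 2, δ, by positivity, by linarith⟩
  have hg : ContDiff ℝ n fun p : ℝ × Y => b p.2 • f p := by
    rw [contDiff_iff_contDiffAt]
    intro p
    by_cases hp : p.2 ∈ U
    · have h1 : ContDiffAt ℝ n f p :=
        hf.contDiffAt ((isOpen_univ.prod hU).mem_nhds ⟨mem_univ _, hp⟩)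
      have h2 : ContDiffAt ℝ n (fun p : ℝ × Y => b p.2) p := b.contDiff.contDiffAt.comp p contDiffAt_snd
      exact h2.smul h1
    · have hsupp : p.2 ∉ tsupport b := fun h => hp (hδU (by rwa [b.tsupport_eq] at h))
      have h0 : ∀ᶠ y in 𝓝 p.2, b y = 0 := by
        filter_upwards [(isClosed_tsupport b).isOpen_compl.mem_nhds hsupp] with y hy
        exact image_eq_zero_of_notMem_tsupport hy
      have h1 : (fun p : ℝ × Y => b p.2 • f p) =ᶠ[𝓝 p] fun _ => 0 := by
        filter_upwards [continuous_snd.continuousAt.eventually h0] with q hq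
        rw [hq, zero_smul]
      exact contDiffAt_const.congr_of_eventuallyEq h1
  refine ⟨⟨_, hg.continuous⟩, hg, ?_⟩
  filter_upwards [b.eventuallyEq_one] with y hy t
  simp [hy]

namespace NonsmoothSystem

variable {d N M r : ℕ} (S : NonsmoothSystem d N M r)

/-- The field of the zone `j` divided by `ε`. -/
noncomputable def scaledField (j : Fin (M + 1)) (p : ℝ × EuclideanSpace ℝ (Fin d) × ℝ) :
    EuclideanSpace ℝ (Fin d) :=
  ∑ i ∈ Finset.Icc 1 N, p.2.2 ^ (i - 1) • S.F i j p.1 p.2.1 + p.2.2 ^ N • S.R j p.1 p.2.1 p.2.2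

theorem field_eq_smul (j : Fin (M + 1)) (t : ℝ) (x : EuclideanSpace ℝ (Fin d)) (ε : ℝ) :
    S.field j t x ε = ε • S.scaledField j (t, x, ε) := by
  simp only [field, scaledField, smul_add, Finset.smul_sum, smul_smul]
  congr 1
  · refine Finset.sum_congr rfl fun i hi => ?_
    rw [mul_pow_sub_one (by have := (Finset.mem_Icc.1 hi).1; omega)]
  · rw [pow_succ']

theorem contDiffOn_scaledField (j : Fin (M + 1)) :
    ContDiffOn ℝ r (S.scaledField j) (univ ×ˢ (S.D ×ˢ Ioo (-S.ε₀) S.ε₀)) := by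
  unfold scaledField
  have hpow : ∀ m : ℕ, ContDiff ℝ r fun p : ℝ × EuclideanSpace ℝ (Fin d) × ℝ => p.2.2 ^ m :=
    fun m => by fun_prop
  refine ContDiffOn.add (ContDiffOn.sum fun i hi => (hpow (i - 1)).contDiffOn.smul ?_)
    ((hpow N).contDiffOn.smul (S.R_smooth j))
  have hm : ContDiffOn ℝ r (fun p : ℝ × EuclideanSpace ℝ (Fin d) × ℝ => (p.1, p.2.1))
      (univ ×ˢ (S.D ×ˢ Ioo (-S.ε₀) S.ε₀)) := by fun_prop
  exact (S.F_smooth i hi j).comp hm fun p hp => ⟨mem_univ _, hp.2.1⟩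

/-- Data of the system near `(x₀, ε = 0)`: globally defined fields `h j` which agree with the
scaled fields near the point, a bound `C` for the speed and a Lipschitz constant `K` for the
switching functions. -/
structure LocalData (x₀ : EuclideanSpace ℝ (Fin d)) where
  /-- the scaled fields of the zones, cut off -/
  h : Fin (M + 1) → C(ℝ × EuclideanSpace ℝ (Fin d) × ℝ, EuclideanSpace ℝ (Fin d))
  contDiff_h : ∀ j, ContDiff ℝ 2 (h j)
  /-- the radius of the neighbourhood, in `x` and in `ε` -/
  δ : ℝ
  δ_pos : 0 < δ
  subset_D : Metric.closedBall x₀ δ ⊆ S.D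
  h_eq : ∀ j t, ∀ x ∈ Metric.closedBall x₀ δ, ∀ ε : ℝ, |ε| ≤ δ →
    h j (t, x, ε) = S.scaledField j (t, x, ε)
  /-- a bound for the scaled fields -/
  C : ℝ
  C_nonneg : 0 ≤ C
  norm_h_le : ∀ j, ∀ t ∈ Icc 0 S.T, ∀ x ∈ Metric.closedBall x₀ δ, ∀ ε : ℝ, |ε| ≤ δ →
    ‖h j (t, x, ε)‖ ≤ C
  /-- a Lipschitz constant for the switching functions -/
  K : ℝ
  K_nonneg : 0 ≤ K
  lipschitz_θ : ∀ k, ∀ x ∈ Metric.closedBall x₀ δ, ∀ y ∈ Metric.closedBall x₀ δ,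
    |S.θ k x - S.θ k y| ≤ K * ‖x - y‖

theorem nonempty_localData (hr : 2 ≤ r) {x₀ : EuclideanSpace ℝ (Fin d)} (hx₀ : x₀ ∈ S.D) :
    Nonempty (S.LocalData x₀) := by
  have hr' : ((2 : ℕ) : WithTop ℕ∞) ≤ r := by exact_mod_cast hr
  have hU : IsOpen (S.D ×ˢ Ioo (-S.ε₀) S.ε₀) := S.isOpen_D.prod isOpen_Ioo
  have hmem : (x₀, (0 : ℝ)) ∈ S.D ×ˢ Ioo (-S.ε₀) S.ε₀ :=
    ⟨hx₀, by simpa using S.ε₀_pos⟩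
  choose h hh heq using fun j =>
    exists_contDiff_eq_of_contDiffOn hU ((S.contDiffOn_scaledField j).of_le hr') hmem
  have hθ : ∀ k, ∃ K, ∃ t ∈ 𝓝 x₀, LipschitzOnWith K (S.θ k) t := fun k =>
    (((S.θ_smooth k).of_le hr').contDiffAt (S.isOpen_D.mem_nhds hx₀)).of_le
      (by norm_num) |>.exists_lipschitzOnWith
  choose K t ht hK using hθ
  have hev : ∀ᶠ v in 𝓝 (x₀, (0 : ℝ)), (∀ j, ∀ t, h j (t, v) = S.scaledField j (t, v)) ∧
      v.1 ∈ S.D ∧ ∀ k, v.1 ∈ t k := by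
    have h2 : ∀ᶠ x in 𝓝 x₀, x ∈ S.D ∧ ∀ k, x ∈ t k :=
      (S.isOpen_D.eventually_mem hx₀).and (eventually_all.2 ht)
    exact (eventually_all.2 heq).and (h2.prod_inl_nhds 0)
  obtain ⟨δ, hδ, hδs⟩ := Metric.nhds_basis_closedBall.mem_iff.1 hev
  rw [← closedBall_prod_same] at hδs
  have hin : ∀ x ∈ Metric.closedBall x₀ δ, ∀ ε : ℝ, |ε| ≤ δ →
      (∀ j, ∀ t, h j (t, x, ε) = S.scaledField j (t, x, ε)) ∧ x ∈ S.D ∧ ∀ k, x ∈ t k :=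
    fun x hx ε hε => hδs (mk_mem_prod hx (by simpa using hε))
  have h0 : |(0 : ℝ)| ≤ δ := by simpa using hδ.le
  have hcomp : IsCompact (Icc 0 S.T ×ˢ (Metric.closedBall x₀ δ ×ˢ Metric.closedBall (0 : ℝ) δ)) :=
    isCompact_Icc.prod ((isCompact_closedBall _ _).prod (isCompact_closedBall _ _))
  choose C hC using fun j => hcomp.exists_bound_of_continuousOn (h j).continuous.continuousOn
  refine ⟨{
    h := h
    contDiff_h := hh
    δ := δ
    δ_pos := hδ
    subset_D := fun x hx => (hin x hx 0 h0).2.1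
    h_eq := fun j t x hx ε hε => (hin x hx ε hε).1 j t
    C := ∑ j, |C j|
    C_nonneg := Finset.sum_nonneg fun _ _ => abs_nonneg _
    norm_h_le := fun j t ht x hx ε hε =>
      (hC j (t, x, ε) ⟨ht, hx, by simpa using hε⟩).trans ((le_abs_self _).trans
        (Finset.single_le_sum (f := fun j => |C j|) (fun _ _ => abs_nonneg _) (Finset.mem_univ j)))
    K := ∑ k, (K k : ℝ)
    K_nonneg := Finset.sum_nonneg fun _ _ => NNReal.coe_nonneg _
    lipschitz_θ := fun k x hx y hy => ?_ }⟩
  have h1 := (hK k).norm_sub_le ((hin x hx 0 h0).2.2 k) ((hin y hy 0 h0).2.2 k)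
  rw [Real.norm_eq_abs] at h1
  refine h1.trans (mul_le_mul_of_nonneg_right ?_ (norm_nonneg _))
  exact Finset.single_le_sum (f := fun k => (K k : ℝ)) (fun _ _ => NNReal.coe_nonneg _)
    (Finset.mem_univ k)

theorem θ_mem_Icc {x : EuclideanSpace ℝ (Fin d)} (hx : x ∈ S.D) (k : Fin (M + 2)) :
    S.θ k x ∈ Icc 0 S.T :=
  ⟨(S.θ_zero x hx).symm.trans_le ((S.θ_strictMono x hx).monotone (Fin.zero_le k)),
    ((S.θ_strictMono x hx).monotone (Fin.le_last k)).trans_eq (S.θ_last x hx)⟩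

theorem velocities_of_mem {x : EuclideanSpace ℝ (Fin d)} (hx : x ∈ S.D) {ε t : ℝ}
    {j : Fin (M + 1)} (ht : t ∈ Ioo (S.θ j.castSucc x) (S.θ j.succ x)) :
    S.velocities ε t x = {S.field j t x ε} := by
  have : {v | ∃ j : Fin (M + 1), S.θ j.castSucc x ≤ t ∧ t ≤ S.θ j.succ x ∧
      v = S.field j t x ε} = {S.field j t x ε} := by
    ext v
    constructor
    · rintro ⟨i, h1, h2, rfl⟩
      rw [eq_of_mem_zones (S.θ_strictMono x hx) ⟨h1, h2⟩ ht]
      rfl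
    · rintro rfl
      exact ⟨j, ht.1.le, ht.2.le, rfl⟩
  rw [velocities, this, convexHull_singleton]

end NonsmoothSystem

/-! ### Solutions and orbits -/

namespace NonsmoothSystem

variable {d N M r : ℕ} {S : NonsmoothSystem d N M r} {x₀ : EuclideanSpace ℝ (Fin d)}

namespace LocalData

variable (L : S.LocalData x₀)

/-- The starting point `ξ` and the parameter `ε` are so close to `x₀` and `0` that the solutions
starting at `ξ` stay in the neighbourhood and cross the switching surfaces transversally. -/
def Small (ξ : EuclideanSpace ℝ (Fin d)) (ε : ℝ) : Prop :=
  |ε| ≤ L.δ ∧ ‖ξ - x₀‖ + L.C * |ε| * S.T < L.δ ∧ L.K * (L.C * |ε|) < 1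

theorem eventually_small : ∀ᶠ p in 𝓝 (x₀, (0 : ℝ)), L.Small p.1 p.2 := by
  have h1 : ∀ᶠ p : EuclideanSpace ℝ (Fin d) × ℝ in 𝓝 (x₀, (0 : ℝ)), |p.2| < L.δ :=
    ContinuousAt.eventually_lt (by fun_prop) continuousAt_const (by simpa using L.δ_pos)
  have h2 : ∀ᶠ p : EuclideanSpace ℝ (Fin d) × ℝ in 𝓝 (x₀, (0 : ℝ)),
      ‖p.1 - x₀‖ + L.C * |p.2| * S.T < L.δ :=
    ContinuousAt.eventually_lt (by fun_prop) continuousAt_const (by simpa using L.δ_pos)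
  have h3 : ∀ᶠ p : EuclideanSpace ℝ (Fin d) × ℝ in 𝓝 (x₀, (0 : ℝ)), L.K * (L.C * |p.2|) < 1 :=
    ContinuousAt.eventually_lt (by fun_prop) continuousAt_const (by simp)
  filter_upwards [h1, h2, h3] with p h1 h2 h3 using ⟨h1.le, h2, h3⟩

theorem field_eq (j : Fin (M + 1)) (t : ℝ) {x : EuclideanSpace ℝ (Fin d)}
    (hx : x ∈ Metric.closedBall x₀ L.δ) {ε : ℝ} (hε : |ε| ≤ L.δ) :
    S.field j t x ε = ε • L.h j (t, x, ε) := by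
  rw [S.field_eq_smul, L.h_eq j t x hx ε hε]

theorem norm_smul_h_le (j : Fin (M + 1)) {t : ℝ} (ht : t ∈ Icc 0 S.T)
    {x : EuclideanSpace ℝ (Fin d)} (hx : x ∈ Metric.closedBall x₀ L.δ) {ε : ℝ} (hε : |ε| ≤ L.δ) :
    ‖ε • L.h j (t, x, ε)‖ ≤ L.C * |ε| := by
  rw [norm_smul, Real.norm_eq_abs, mul_comm]
  exact mul_le_mul_of_nonneg_right (L.norm_h_le j t ht x hx ε hε) (abs_nonneg _)

theorem norm_le_of_mem_velocities {t : ℝ} (ht : t ∈ Icc 0 S.T)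
    {x v : EuclideanSpace ℝ (Fin d)} (hx : x ∈ Metric.closedBall x₀ L.δ) {ε : ℝ}
    (hε : |ε| ≤ L.δ) (hv : v ∈ S.velocities ε t x) : ‖v‖ ≤ L.C * |ε| := by
  have hsub : S.velocities ε t x ⊆ Metric.closedBall 0 (L.C * |ε|) := by
    refine convexHull_min ?_ (convex_closedBall _ _)
    rintro _ ⟨j, -, -, rfl⟩
    rw [mem_closedBall_zero_iff, L.field_eq j t hx hε]
    exact L.norm_smul_h_le j ht hx hε
  simpa using hsub hv

/-- The curve `x` moves in the `j`-th zone with velocity `ε • h j` for times between `τ j` and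
`τ (j + 1)`, and crosses the `k`-th switching surface at the time `τ k`. -/
structure IsOrbit (ε : ℝ) (x : ℝ → EuclideanSpace ℝ (Fin d)) (τ : Fin (M + 2) → ℝ) : Prop where
  mem : ∀ t ∈ Icc 0 S.T, x t ∈ Metric.ball x₀ L.δ
  continuousOn : ContinuousOn x (Icc 0 S.T)
  strictMono : StrictMono τ
  zero : τ 0 = 0
  last : τ (Fin.last (M + 1)) = S.T
  crossing : ∀ k, S.θ k (x (τ k)) = τ k
  integral : ∀ t ∈ Icc 0 S.T,
    x t = x 0 + ∫ s in (0 : ℝ)..t, piecewiseOn τ (fun j s => ε • L.h j (s, x s, ε)) s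

theorem crossing_order {x : ℝ → EuclideanSpace ℝ (Fin d)} {ε : ℝ}
    (hε : L.K * (L.C * |ε|) < 1) (hmem : ∀ t ∈ Icc 0 S.T, x t ∈ Metric.ball x₀ L.δ)
    (hlip : ∀ s ∈ Icc 0 S.T, ∀ t ∈ Icc 0 S.T, s ≤ t → ‖x t - x s‖ ≤ L.C * |ε| * (t - s))
    {k : Fin (M + 2)} {τ : ℝ} (hτ : τ ∈ Icc 0 S.T) (hk : S.θ k (x τ) = τ) {t : ℝ}
    (ht : t ∈ Icc 0 S.T) : (t < τ → t < S.θ k (x t)) ∧ (τ < t → S.θ k (x t) < t) := by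
  refine _root_.crossing_order (g := fun t => S.θ k (x t)) hε ?_ hτ hk ht
  intro s hs t ht hst
  have := L.lipschitz_θ k _ (Metric.ball_subset_closedBall (hmem t ht)) _
    (Metric.ball_subset_closedBall (hmem s hs))
  refine this.trans ?_
  rw [mul_assoc]
  exact mul_le_mul_of_nonneg_left (hlip s hs t ht hst) L.K_nonneg

/-- Solutions are orbits: by the speed bound each `t - θ_k(x(t))` is strictly increasing, so that
the velocity is determined except at finitely many times. -/
theorem exists_isOrbit {x : ℝ → EuclideanSpace ℝ (Fin d)} {ε : ℝ} (hx : S.IsSolution ε x)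
    (hsmall : L.Small (x 0) ε) : ∃ τ, L.IsOrbit ε x τ := by
  obtain ⟨hε, hδ, hκ⟩ := hsmall
  obtain ⟨hD, v, hv, hvel, hint⟩ := hx
  have hT := S.T_pos.le
  have hmem : ∀ t ∈ Icc 0 S.T, x t ∈ Metric.ball x₀ L.δ := fun t ht =>
    mem_ball_of_ae_norm_le (mul_nonneg L.C_nonneg (abs_nonneg ε)) hv hint (by
      filter_upwards [hvel] with s hs hsT hsx
      exact L.norm_le_of_mem_velocities hsT hsx hε (hs hsT)) hδ ht
  have hlip : ∀ s ∈ Icc 0 S.T, ∀ t ∈ Icc 0 S.T, s ≤ t → ‖x t - x s‖ ≤ L.C * |ε| * (t - s) := by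
    intro s hs t ht hst
    refine norm_sub_le_of_ae_norm_le hv hint hs.1 hst ht.2 ?_
    filter_upwards [hvel] with a ha haI
    have haT : a ∈ Icc 0 S.T := ⟨hs.1.trans haI.1.le, haI.2.trans ht.2⟩
    exact L.norm_le_of_mem_velocities haT (Metric.ball_subset_closedBall (hmem a haT)) hε (ha haT)
  have hcont := continuousOn_of_eq_add_integral hT hv hint
  have hcr : ∀ k, ∃ τ ∈ Icc 0 S.T, S.θ k (x τ) = τ := fun k =>
    exists_crossing (g := fun t => S.θ k (x t)) hT ((S.θ_smooth k).continuousOn.comp hcont hD)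
      fun t ht => S.θ_mem_Icc (hD t ht) k
  choose τ hτT hτ using hcr
  have horder : ∀ k t, t ∈ Icc 0 S.T →
      (t < τ k → t < S.θ k (x t)) ∧ (τ k < t → S.θ k (x t) < t) :=
    fun k t ht => L.crossing_order hκ hmem hlip (hτT k) (hτ k) ht
  have hmono : StrictMono τ := by
    intro i j hij
    have h1 : τ i < S.θ j (x (τ i)) := by
      conv_lhs => rw [← hτ i]
      exact S.θ_strictMono _ (hD _ (hτT i)) hij
    rcases lt_trichotomy (τ i) (τ j) with h | h | h
    · exact h
    · rw [h, hτ j] at h1; exact absurd h1 (lt_irrefl _)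
    · exact absurd h1 (not_lt.2 ((horder j _ (hτT i)).2 h).le)
  refine ⟨τ, hmem, hcont, hmono, ?_, ?_, hτ, fun t ht => ?_⟩
  · rw [← hτ 0, S.θ_zero _ (hD _ (hτT 0))]
  · rw [← hτ (Fin.last _), S.θ_last _ (hD _ (hτT _))]
  · rw [hint t ht]
    congr 1
    refine intervalIntegral.integral_congr_ae ?_
    filter_upwards [hvel, ae_notMem_range τ] with s hs hsτ hst
    rw [uIoc_of_le ht.1] at hst
    have hsT : s ∈ Icc 0 S.T := ⟨hst.1.le, hst.2.trans ht.2⟩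
    obtain ⟨j, hj⟩ := exists_mem_zone_of_notMem_range τ (s := s)
      ⟨(hmono.monotone (Fin.zero_le _)).trans (by
        rw [← hτ 0, S.θ_zero _ (hD _ (hτT 0))]; exact hsT.1), by
        rw [← hτ (Fin.last _), S.θ_last _ (hD _ (hτT _))]; exact hsT.2⟩ hsτ
    have hvs := hs hsT
    rw [S.velocities_of_mem (hD s hsT) (j := j)
      ⟨(horder _ s hsT).2 hj.1, (horder _ s hsT).1 hj.2⟩, mem_singleton_iff] at hvs
    rw [piecewiseOn_of_mem hmono _ hj, hvs,
      L.field_eq j s (Metric.ball_subset_closedBall (hmem s hsT)) hε]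

variable {L}

theorem IsOrbit.time_mem {x : ℝ → EuclideanSpace ℝ (Fin d)} {ε : ℝ} {τ : Fin (M + 2) → ℝ}
    (hx : L.IsOrbit ε x τ) (k : Fin (M + 2)) : τ k ∈ Icc 0 S.T :=
  ⟨hx.zero ▸ hx.strictMono.monotone (Fin.zero_le k),
    hx.last ▸ hx.strictMono.monotone (Fin.le_last k)⟩

theorem IsOrbit.zone_subset {x : ℝ → EuclideanSpace ℝ (Fin d)} {ε : ℝ} {τ : Fin (M + 2) → ℝ}
    (hx : L.IsOrbit ε x τ) (j : Fin (M + 1)) : Icc (τ j.castSucc) (τ j.succ) ⊆ Icc 0 S.T :=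
  Icc_subset_Icc (hx.time_mem _).1 (hx.time_mem _).2

theorem IsOrbit.ae_exists_mem_zone {x : ℝ → EuclideanSpace ℝ (Fin d)} {ε : ℝ}
    {τ : Fin (M + 2) → ℝ} (hx : L.IsOrbit ε x τ) :
    ∀ᵐ s : ℝ, s ∈ Icc 0 S.T → ∃ j : Fin (M + 1), s ∈ Ioo (τ j.castSucc) (τ j.succ) := by
  filter_upwards [ae_notMem_range τ] with s hsτ hsT
  exact exists_mem_zone_of_notMem_range τ (by rwa [hx.zero, hx.last]) hsτ

theorem IsOrbit.intervalIntegrable {x : ℝ → EuclideanSpace ℝ (Fin d)} {ε : ℝ}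
    {τ : Fin (M + 2) → ℝ} (hx : L.IsOrbit ε x τ) :
    IntervalIntegrable (piecewiseOn τ (fun j s => ε • L.h j (s, x s, ε))) volume 0 S.T :=
  intervalIntegrable_piecewiseOn hx.strictMono.monotone (intervalIntegrable_zoneField
    (X := fun _ => x) hx.strictMono fun j => hx.continuousOn.mono (hx.zone_subset j)) _ _

theorem IsOrbit.norm_sub_le {x : ℝ → EuclideanSpace ℝ (Fin d)} {ε : ℝ} {τ : Fin (M + 2) → ℝ}
    (hx : L.IsOrbit ε x τ) (hε : |ε| ≤ L.δ) {s t : ℝ} (hs : s ∈ Icc 0 S.T) (ht : t ∈ Icc 0 S.T)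
    (hst : s ≤ t) : ‖x t - x s‖ ≤ L.C * |ε| * (t - s) := by
  refine norm_sub_le_of_ae_norm_le hx.intervalIntegrable hx.integral hs.1 hst ht.2 ?_
  filter_upwards [hx.ae_exists_mem_zone] with a ha haI
  have haT : a ∈ Icc 0 S.T := ⟨hs.1.trans haI.1.le, haI.2.trans ht.2⟩
  obtain ⟨j, hj⟩ := ha haT
  rw [piecewiseOn_of_mem hx.strictMono _ hj]
  exact L.norm_smul_h_le j haT (Metric.ball_subset_closedBall (hx.mem a haT)) hε

theorem IsOrbit.isSolution {x : ℝ → EuclideanSpace ℝ (Fin d)} {ε : ℝ} {τ : Fin (M + 2) → ℝ}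
    (hx : L.IsOrbit ε x τ) (hε : |ε| ≤ L.δ) (hκ : L.K * (L.C * |ε|) < 1) : S.IsSolution ε x := by
  have hD : ∀ t ∈ Icc 0 S.T, x t ∈ S.D := fun t ht =>
    L.subset_D (Metric.ball_subset_closedBall (hx.mem t ht))
  have horder : ∀ k t, t ∈ Icc 0 S.T →
      (t < τ k → t < S.θ k (x t)) ∧ (τ k < t → S.θ k (x t) < t) :=
    fun k t ht => L.crossing_order hκ hx.mem (fun s hs t ht => hx.norm_sub_le hε hs ht)
      (hx.time_mem k) (hx.crossing k) ht
  refine ⟨hD, _, hx.intervalIntegrable, ?_, hx.integral⟩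
  filter_upwards [hx.ae_exists_mem_zone] with s hs hsT
  obtain ⟨j, hj⟩ := hs hsT
  rw [S.velocities_of_mem (hD s hsT) (j := j)
    ⟨(horder _ s hsT).2 hj.1, (horder _ s hsT).1 hj.2⟩, mem_singleton_iff,
    piecewiseOn_of_mem hx.strictMono _ hj,
    L.field_eq j s (Metric.ball_subset_closedBall (hx.mem s hsT)) hε]

/-- The pieces of an orbit, as curves on the unit interval. -/
noncomputable def IsOrbit.pieces {x : ℝ → EuclideanSpace ℝ (Fin d)} {ε : ℝ} {τ : Fin (M + 2) → ℝ}
    (hx : L.IsOrbit ε x τ) : Pieces (EuclideanSpace ℝ (Fin d)) M :=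
  (fun j => ⟨fun u => x (τ j.castSucc + u * (τ j.succ - τ j.castSucc)),
    hx.continuousOn.comp_continuous (by fun_prop) fun u =>
      hx.zone_subset j (affine_mem_Icc (hx.strictMono Fin.castSucc_lt_succ).le u)⟩, τ)

theorem IsOrbit.piecesMap_eq {x : ℝ → EuclideanSpace ℝ (Fin d)} {ε : ℝ} {τ : Fin (M + 2) → ℝ}
    (hx : L.IsOrbit ε x τ) : piecesMap L.h S.θ ((x 0, ε), hx.pieces) = hx.pieces := by
  refine (piecesMap_eq_iff (X := fun _ => x) hx.strictMono
    (fun j => hx.continuousOn.mono (hx.zone_subset j)) (fun j u => rfl) (x := x) ?_).2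
    ⟨fun j u => rfl, hx.crossing⟩
  rw [hx.zero, hx.last]
  exact hx.integral

theorem IsOrbit.eqOn {x y : ℝ → EuclideanSpace ℝ (Fin d)} {ε ε' : ℝ} {τ σ : Fin (M + 2) → ℝ}
    (hx : L.IsOrbit ε x τ) (hy : L.IsOrbit ε' y σ) (hxy : hx.pieces = hy.pieces) :
    EqOn x y (Icc 0 S.T) := by
  have hτσ : τ = σ := congrArg Prod.snd hxy
  subst hτσ
  intro t ht
  obtain ⟨j, hj⟩ := exists_mem_zone τ (s := t) (by rwa [hx.zero, hx.last])
  obtain ⟨u, rfl⟩ := exists_affine_eq (hx.strictMono Fin.castSucc_lt_succ) hj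
  exact DFunLike.congr_fun (congrFun (congrArg Prod.fst hxy) j) u

/-- A fixed point of `piecesMap` with increasing times defines an orbit. -/
theorem exists_isOrbit_of_piecesMap_eq {ξ : EuclideanSpace ℝ (Fin d)} {ε : ℝ}
    {z : Fin (M + 1) → C(unitInterval, EuclideanSpace ℝ (Fin d))} {τ : Fin (M + 2) → ℝ}
    (hτ : StrictMono τ) (h0 : τ 0 = 0) (hlast : τ (Fin.last (M + 1)) = S.T)
    (hz : ∀ j u, z j u ∈ Metric.ball x₀ L.δ)
    (hfix : piecesMap L.h S.θ ((ξ, ε), (z, τ)) = (z, τ)) :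
    ∃ x, x 0 = ξ ∧ L.IsOrbit ε x τ ∧
      x S.T = ξ + ε • increment L.h (Fin.last (M + 1)) (ε, (z, τ)) := by
  have hpos : ∀ j : Fin (M + 1), 0 < τ j.succ - τ j.castSucc := fun j =>
    sub_pos.2 (hτ Fin.castSucc_lt_succ)
  let X : Fin (M + 1) → ℝ → EuclideanSpace ℝ (Fin d) := fun j s =>
    IccExtend zero_le_one (z j) ((s - τ j.castSucc) / (τ j.succ - τ j.castSucc))
  have hXc : ∀ j, Continuous (X j) := fun j =>
    ((z j).continuous.Icc_extend' (h := zero_le_one)).comp (by fun_prop)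
  have hX : ∀ j, ∀ u : unitInterval,
      X j (τ j.castSucc + u * (τ j.succ - τ j.castSucc)) = z j u := by
    intro j u
    have : (τ j.castSucc + u * (τ j.succ - τ j.castSucc) - τ j.castSucc) /
        (τ j.succ - τ j.castSucc) = u := by
      rw [add_sub_cancel_left, mul_div_cancel_right₀ _ (hpos j).ne']
    simp only [X, this]
    exact IccExtend_val zero_le_one (z j) u
  let x : ℝ → EuclideanSpace ℝ (Fin d) := fun t =>
    ξ + ∫ s in τ 0..t, piecewiseOn τ (fun j s => ε • L.h j (s, X j s, ε)) s
  obtain ⟨hxz, hcr⟩ := (piecesMap_eq_iff (X := X) (x := x) hτ (fun j => (hXc j).continuousOn) hX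
    (fun _ _ => rfl)).1 hfix
  have hx0 : x 0 = ξ := by simp [x, h0]
  have hI : IntervalIntegrable (piecewiseOn τ (fun j s => ε • L.h j (s, X j s, ε))) volume 0 S.T :=
    intervalIntegrable_piecewiseOn hτ.monotone
      (intervalIntegrable_zoneField hτ fun j => (hXc j).continuousOn) _ _
  have hxint : ∀ t ∈ Icc 0 S.T, x t = x 0 + ∫ s in (0 : ℝ)..t,
      piecewiseOn τ (fun j s => ε • L.h j (s, X j s, ε)) s := by
    intro t _
    rw [hx0]; simp only [x, h0]
  refine ⟨x, hx0, ⟨fun t ht => ?_, continuousOn_of_eq_add_integral S.T_pos.le hI hxint, hτ, h0,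
    hlast, hcr, fun t ht => ?_⟩, ?_⟩
  · obtain ⟨j, hj⟩ := exists_mem_zone τ (s := t) (by rwa [h0, hlast])
    obtain ⟨u, rfl⟩ := exists_affine_eq (hτ Fin.castSucc_lt_succ) hj
    rw [hxz]
    exact hz j u
  · rw [hxint t ht]
    congr 1
    refine intervalIntegral.integral_congr fun s _ => ?_
    simp only [piecewiseOn]
    refine Finset.sum_congr rfl fun j _ => ?_
    by_cases hs : s ∈ Ioo (τ j.castSucc) (τ j.succ)
    · obtain ⟨u, rfl⟩ := exists_affine_eq (hτ Fin.castSucc_lt_succ) (Ioo_subset_Icc_self hs)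
      rw [indicator_of_mem hs, indicator_of_mem hs, hX, hxz]
    · rw [indicator_of_notMem hs, indicator_of_notMem hs]
  · rw [smul_increment_eq hτ (fun j => (hXc j).continuousOn) hX, hlast]

end LocalData

end NonsmoothSystem

/-! ### Identification of the Melnikov functions -/

namespace NonsmoothSystem

variable {d N M r : ℕ} {S : NonsmoothSystem d N M r} {x₀ : EuclideanSpace ℝ (Fin d)}

namespace LocalData

variable {L : S.LocalData x₀}

/-- Orbits which start near `x₀` lie in the neighbourhood where fixed points are unique. -/
theorem IsOrbit.dist_pieces_le {x : ℝ → EuclideanSpace ℝ (Fin d)} {ε : ℝ} {τ : Fin (M + 2) → ℝ}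
    (hx : L.IsOrbit ε x τ) (hε : |ε| ≤ L.δ) :
    dist hx.pieces (restPieces S.θ x₀) ≤ (1 + L.K) * (‖x 0 - x₀‖ + L.C * |ε| * S.T) := by
  have hT := S.T_pos.le
  have hK := L.K_nonneg
  have hc : 0 ≤ L.C * |ε| := mul_nonneg L.C_nonneg (abs_nonneg ε)
  have hB : 0 ≤ ‖x 0 - x₀‖ + L.C * |ε| * S.T := by positivity
  have hxt : ∀ t ∈ Icc 0 S.T, ‖x t - x₀‖ ≤ ‖x 0 - x₀‖ + L.C * |ε| * S.T := by
    intro t ht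
    have h1 := hx.norm_sub_le hε ⟨le_rfl, hT⟩ ht ht.1
    have h2 : L.C * |ε| * (t - 0) ≤ L.C * |ε| * S.T := by
      rw [sub_zero]; exact mul_le_mul_of_nonneg_left ht.2 hc
    linarith [norm_sub_le_norm_sub_add_norm_sub (x t) (x 0) x₀]
  rw [dist_eq_norm]
  refine norm_prod_le_iff.2 ⟨(pi_norm_le_iff_of_nonneg (by positivity)).2 fun j =>
    (ContinuousMap.norm_le _ (by positivity)).2 fun u => ?_,
    (pi_norm_le_iff_of_nonneg (by positivity)).2 fun k => ?_⟩
  · refine (hxt _ (hx.zone_subset j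
      (affine_mem_Icc (hx.strictMono Fin.castSucc_lt_succ).le u))).trans ?_
    nlinarith
  · have h1 := L.lipschitz_θ k _ (Metric.ball_subset_closedBall (hx.mem _ (hx.time_mem k))) x₀
      (Metric.mem_closedBall_self L.δ_pos.le)
    rw [hx.crossing k] at h1
    refine h1.trans ((mul_le_mul_of_nonneg_left (hxt _ (hx.time_mem k)) hK).trans ?_)
    nlinarith

variable (L)

theorem h_zero (hN : 1 ≤ N) (j : Fin (M + 1)) (s : ℝ) {x : EuclideanSpace ℝ (Fin d)}
    (hx : x ∈ Metric.closedBall x₀ L.δ) : L.h j (s, x, 0) = S.F 1 j s x := by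
  rw [L.h_eq j s x hx 0 (by simpa using L.δ_pos.le), scaledField,
    Finset.sum_eq_single_of_mem 1 (Finset.mem_Icc.2 ⟨le_rfl, hN⟩)]
  · simp [zero_pow (show N ≠ 0 by omega)]
  · intro i hi h1
    have := (Finset.mem_Icc.1 hi).1
    simp [zero_pow (show i - 1 ≠ 0 by omega)]

/-- The coefficient of `ε` in the scaled field is `F_2`; for `N = 1` it would involve `R`. -/
theorem fderiv_h (hN : 2 ≤ N) (hr : 1 ≤ r) (j : Fin (M + 1)) (s : ℝ)
    {x : EuclideanSpace ℝ (Fin d)} (hx : x ∈ Metric.ball x₀ L.δ) (y : EuclideanSpace ℝ (Fin d)) :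
    fderiv ℝ (L.h j) (s, x, 0) (0, y, 1) =
      fderiv ℝ (fun z => S.F 1 j s z) x y + S.F 2 j s x := by
  have hd : HasFDerivAt (L.h j) (fderiv ℝ (L.h j) (s, x, 0)) (s, x, 0) :=
    ((L.contDiff_h j).differentiable (by norm_num) _).hasFDerivAt
  have hx' := Metric.ball_subset_closedBall hx
  have hxD := L.subset_D hx'
  have hsplit : ((0, y, 1) : ℝ × EuclideanSpace ℝ (Fin d) × ℝ) = (0, y, 0) + (0, 0, 1) := by simp
  rw [hsplit, map_add]
  congr 1
  · have h1 : HasFDerivAt (fun z => L.h j (s, z, 0)) (fderiv ℝ (L.h j) (s, x, 0) ∘L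
        (ContinuousLinearMap.inr ℝ ℝ _ ∘L ContinuousLinearMap.inl ℝ _ ℝ)) x :=
      HasFDerivAt.comp x (f := fun z => (s, z, (0 : ℝ))) hd
        ((hasFDerivAt_prodMk_right s (x, (0 : ℝ))).comp x (hasFDerivAt_prodMk_left x (0 : ℝ)))
    have h2 : (fun z => S.F 1 j s z) =ᶠ[𝓝 x] fun z => L.h j (s, z, 0) := by
      filter_upwards [Metric.isOpen_ball.mem_nhds hx] with z hz
      exact (L.h_zero (by omega) j s (Metric.ball_subset_closedBall hz)).symm
    rw [h2.fderiv_eq, h1.fderiv]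
    rfl
  · have h1 : HasDerivAt (fun e : ℝ => L.h j (s, x, e)) (fderiv ℝ (L.h j) (s, x, 0) (0, 0, 1)) 0 :=
      hd.comp_hasDerivAt (0 : ℝ) ((hasDerivAt_const (0 : ℝ) s).prodMk
        ((hasDerivAt_const (0 : ℝ) x).prodMk (hasDerivAt_id (0 : ℝ))))
    have hR : DifferentiableAt ℝ (fun e : ℝ => S.R j s x e) 0 := by
      have hm : (s, x, (0 : ℝ)) ∈ (univ : Set ℝ) ×ˢ S.D ×ˢ Ioo (-S.ε₀) S.ε₀ :=
        ⟨mem_univ _, hxD, by simpa using S.ε₀_pos⟩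
      have h3 := ((S.R_smooth j).contDiffAt ((isOpen_univ.prod
        (S.isOpen_D.prod isOpen_Ioo)).mem_nhds hm)).differentiableAt
          (by exact_mod_cast (show r ≠ 0 by omega))
      exact h3.comp (0 : ℝ) (f := fun e : ℝ => (s, x, e)) (by fun_prop)
    have h2 : HasDerivAt (fun e : ℝ => S.scaledField j (s, x, e)) (S.F 2 j s x) 0 := by
      have hsum := HasDerivAt.fun_sum (u := Finset.Icc 1 N) fun i _ =>
        (hasDerivAt_pow (i - 1) (0 : ℝ)).smul_const (S.F i j s x)
      refine (hsum.add ((hasDerivAt_pow N (0 : ℝ)).smul hR.hasDerivAt)).congr_deriv ?_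
      rw [Finset.sum_eq_single_of_mem 2 (Finset.mem_Icc.2 ⟨by norm_num, hN⟩)]
      · simp [zero_pow (show N ≠ 0 by omega), zero_pow (show N - 1 ≠ 0 by omega)]
      · intro i hi h2
        rcases Nat.lt_or_ge i 2 with h | h
        · have : i - 1 = 0 := by omega
          simp [this]
        · simp [zero_pow (show i - 1 - 1 ≠ 0 by omega)]
    refine h1.unique (h2.congr_of_eventuallyEq ?_)
    filter_upwards [Metric.ball_mem_nhds (0 : ℝ) L.δ_pos] with e he
    exact L.h_eq j s x hx' e (by simpa using (mem_ball_zero_iff.1 he).le)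

end LocalData

theorem fderiv_pwF {x : EuclideanSpace ℝ (Fin d)} (hx : x ∈ S.D) (i : ℕ) {s : ℝ} {j : Fin (M + 1)}
    (hs : s ∈ Ioo (S.θ j.castSucc x) (S.θ j.succ x)) :
    fderiv ℝ (fun z => S.pwF i s z) x = fderiv ℝ (fun z => S.F i j s z) x := by
  refine Filter.EventuallyEq.fderiv_eq ?_
  have hc : ∀ k, ContinuousAt (S.θ k) x := fun k =>
    (S.θ_smooth k).continuousOn.continuousAt (S.isOpen_D.mem_nhds hx)
  filter_upwards [S.isOpen_D.mem_nhds hx, (hc j.castSucc).eventually_lt continuousAt_const hs.1,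
    continuousAt_const.eventually_lt (hc j.succ) hs.2] with z hz h1 h2
  exact piecewiseOn_of_mem (S.θ_strictMono z hz) (fun j s => S.F i j s z) ⟨h1, h2⟩

theorem fderiv_θ_zero {x : EuclideanSpace ℝ (Fin d)} (hx : x ∈ S.D) : fderiv ℝ (S.θ 0) x = 0 := by
  have : S.θ 0 =ᶠ[𝓝 x] fun _ => 0 := by
    filter_upwards [S.isOpen_D.mem_nhds hx] with z hz using S.θ_zero z hz
  rw [this.fderiv_eq, fderiv_fun_const]
  rfl

theorem fderiv_θ_last {x : EuclideanSpace ℝ (Fin d)} (hx : x ∈ S.D) :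
    fderiv ℝ (S.θ (Fin.last (M + 1))) x = 0 := by
  have : S.θ (Fin.last (M + 1)) =ᶠ[𝓝 x] fun _ => S.T := by
    filter_upwards [S.isOpen_D.mem_nhds hx] with z hz using S.θ_last z hz
  rw [this.fderiv_eq, fderiv_fun_const]
  rfl

namespace LocalData

variable (L : S.LocalData x₀)

theorem integral_piecewiseOn_h (hN : 1 ≤ N) {x : EuclideanSpace ℝ (Fin d)}
    (hx : x ∈ Metric.ball x₀ L.δ) (t : ℝ) :
    ∫ s in S.θ 0 x..t, piecewiseOn (fun k => S.θ k x) (fun j s => L.h j (s, x, 0)) s =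
      ∫ s in (0 : ℝ)..t, S.pwF 1 s x := by
  have hx' := Metric.ball_subset_closedBall hx
  rw [S.θ_zero x (L.subset_D hx')]
  simp only [L.h_zero hN _ _ hx']
  rfl

theorem increment_rest_last (hN : 1 ≤ N) {x : EuclideanSpace ℝ (Fin d)}
    (hx : x ∈ Metric.ball x₀ L.δ) :
    increment L.h (Fin.last (M + 1)) (0, restPieces S.θ x) = S.Δ₁ x := by
  have hxD := L.subset_D (Metric.ball_subset_closedBall hx)
  rw [increment_rest (S.θ_strictMono x hxD), L.integral_piecewiseOn_h hN hx, S.θ_last x hxD]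
  rfl

theorem integral_fderiv_h (hN : 2 ≤ N) (hr : 1 ≤ r) {x : EuclideanSpace ℝ (Fin d)}
    (hx : x ∈ Metric.ball x₀ L.δ) {y : ℝ → EuclideanSpace ℝ (Fin d)}
    (hyc : Continuous y) (hy : ∀ t, y t = ∫ s in (0 : ℝ)..t, S.pwF 1 s x) :
    ∑ j : Fin (M + 1), (∫ s in S.θ j.castSucc x..S.θ j.succ x,
      fderiv ℝ (L.h j) (s, x, 0) (0, y s, 1)) = S.f₂ x := by
  have hxD := L.subset_D (Metric.ball_subset_closedBall hx)
  have hτ := S.θ_strictMono x hxD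
  have hf' : ∀ j, Continuous (fderiv ℝ (L.h j)) := fun j =>
    (L.contDiff_h j).continuous_fderiv (by norm_num)
  rw [← sum_castSucc_lt_last, ← integral_piecewiseOn_knot (τ := fun k => S.θ k x)
    (g := fun j s => fderiv ℝ (L.h j) (s, x, 0) (0, y s, 1)) hτ.monotone fun j =>
      Continuous.intervalIntegrable (((hf' j).comp (by fun_prop)).clm_apply (by fun_prop)) _ _,
    S.θ_zero x hxD, S.θ_last x hxD, f₂]
  refine intervalIntegral.integral_congr_ae ?_
  filter_upwards [ae_notMem_range fun k => S.θ k x] with s hs hsT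
  rw [uIoc_of_le S.T_pos.le] at hsT
  obtain ⟨j, hj⟩ := exists_mem_zone_of_notMem_range (fun k => S.θ k x) (s := s)
    (by rw [S.θ_zero x hxD, S.θ_last x hxD]; exact Ioc_subset_Icc_self hsT) hs
  rw [piecewiseOn_of_mem hτ _ hj, L.fderiv_h hN hr j s hx, fderiv_pwF hxD 1 hj, ← hy,
    show S.pwF 2 s x = S.F 2 j s x from piecewiseOn_of_mem hτ (fun j s => S.F 2 j s x) hj]

theorem hasDerivAt_increment (hN : 2 ≤ N) (hr : 1 ≤ r) {x : EuclideanSpace ℝ (Fin d)}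
    (hx : x ∈ Metric.ball x₀ L.δ) {w : ℝ → Pieces (EuclideanSpace ℝ (Fin d)) M}
    (hw : DifferentiableAt ℝ w 0)
    (hfix : ∀ᶠ ε in 𝓝 0, piecesMap L.h S.θ ((x, ε), w ε) = w ε) :
    HasDerivAt (fun ε => increment L.h (Fin.last (M + 1)) (ε, w ε)) (S.Δ₂ x) 0 := by
  have hx' := Metric.ball_subset_closedBall hx
  have hxD := L.subset_D hx'
  have hτ := S.θ_strictMono x hxD
  have hyc : Continuous fun t => ∫ s in (0 : ℝ)..t, S.pwF 1 s x := by
    simp only [← L.integral_piecewiseOn_h (by omega : 1 ≤ N) hx, S.θ_zero x hxD]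
    exact intervalIntegral.continuous_primitive
      (intervalIntegrable_piecewiseOn (τ := fun k => S.θ k x) hτ.monotone
        fun j => Continuous.intervalIntegrable (by fun_prop) _ _) 0
  have hθ : ∀ k, DifferentiableAt ℝ (S.θ k) x := fun k =>
    ((S.θ_smooth k).contDiffAt (S.isOpen_D.mem_nhds hxD)).differentiableAt
      (by exact_mod_cast (show r ≠ 0 by omega))
  have := hasDerivAt_increment_last (fun j => (L.contDiff_h j).of_le (by norm_num)) hτ hθ
    (fderiv_θ_zero hxD) (fderiv_θ_last hxD) hw hfix
    (y := fun t => ∫ s in (0 : ℝ)..t, S.pwF 1 s x)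
    (fun t => (L.integral_piecewiseOn_h (by omega) hx t).symm)
  refine this.congr_deriv ?_
  rw [L.integral_fderiv_h hN hr hx hyc fun _ => rfl, Δ₂]
  simp only [L.h_zero (by omega : 1 ≤ N) _ _ hx']
  rfl

end LocalData

end NonsmoothSystem

/-! ### The displacement function and periodic solutions -/

namespace NonsmoothSystem

variable {d N M r : ℕ} {S : NonsmoothSystem d N M r} {x₀ : EuclideanSpace ℝ (Fin d)}

/-- Near `(x₀, 0)` the displacement is `ε • Q (ξ, ε)` with a `C²` function `Q`, whose expansion in
`ε` starts with `Δ₁` and `Δ₂`; and solutions are unique. -/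
theorem exists_displacement_quotient (hN : 1 ≤ N) (hr : 2 ≤ r) (hx₀ : x₀ ∈ S.D) :
    ∃ Q : EuclideanSpace ℝ (Fin d) × ℝ → EuclideanSpace ℝ (Fin d),
      ContDiffAt ℝ 2 Q (x₀, 0) ∧ (∀ᶠ x in 𝓝 x₀, Q (x, 0) = S.Δ₁ x) ∧
      (2 ≤ N → ∀ᶠ x in 𝓝 x₀, HasDerivAt (fun ε => Q (x, ε)) (S.Δ₂ x) 0) ∧
      ∀ᶠ p in 𝓝 (x₀, (0 : ℝ)), ∃ x, S.IsSolution p.2 x ∧ x 0 = p.1 ∧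
        x S.T = p.1 + p.2 • Q p ∧ ∀ y, S.IsSolution p.2 y → y 0 = p.1 → EqOn y x (Icc 0 S.T) := by
  obtain ⟨L⟩ := S.nonempty_localData hr hx₀
  have hr' : ((2 : ℕ) : WithTop ℕ∞) ≤ r := by exact_mod_cast hr
  obtain ⟨φ, hφ0, hφ, hfix, huniq⟩ := exists_contDiffAt_pieces (n := 2) two_ne_zero
    (h := L.h) (θ := S.θ) L.contDiff_h
    fun k => ((S.θ_smooth k).of_le hr').contDiffAt (S.isOpen_D.mem_nhds hx₀)
  have hball : ∀ᶠ x in 𝓝 x₀, x ∈ Metric.ball x₀ L.δ := Metric.ball_mem_nhds _ L.δ_pos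
  -- restriction of statements at nearby points to the line through `(x, 0)`
  have hline : ∀ x : EuclideanSpace ℝ (Fin d), Tendsto (fun ε : ℝ => (x, ε)) (𝓝 0) (𝓝 (x, 0)) :=
    fun x => Continuous.tendsto (by fun_prop) 0
  have hpoint : Tendsto (fun x : EuclideanSpace ℝ (Fin d) => (x, (0 : ℝ))) (𝓝 x₀) (𝓝 (x₀, 0)) :=
    Continuous.tendsto (by fun_prop) x₀
  have hfixline : ∀ᶠ x in 𝓝 x₀, ∀ᶠ ε in 𝓝 (0 : ℝ),
      piecesMap L.h S.θ ((x, ε), φ (x, ε)) = φ (x, ε) :=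
    (hpoint.eventually hfix.eventually_nhds).mono fun x hx => (hline x).eventually hx
  refine ⟨fun p => increment L.h (Fin.last (M + 1)) (p.2, φ p), ?_, ?_, ?_, ?_⟩
  · exact (contDiff_increment (n := 2) L.contDiff_h _).contDiffAt.comp _
      (contDiffAt_snd.prodMk hφ)
  · filter_upwards [hball, hfixline] with x hx hxfix
    have : φ (x, 0) = restPieces S.θ x := by rw [← hxfix.self_of_nhds, piecesMap_zero]
    simp only [this]
    exact L.increment_rest_last hN hx
  · intro hN2
    filter_upwards [hball, hfixline, hpoint.eventually (hφ.eventually (by decide))]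
      with x hx hxfix hxφ
    have hd : DifferentiableAt ℝ (fun ε : ℝ => φ (x, ε)) 0 :=
      (hxφ.differentiableAt (by norm_num)).comp (0 : ℝ) (f := fun ε : ℝ => (x, ε)) (by fun_prop)
    exact L.hasDerivAt_increment hN2 (by omega) hx hd hxfix
  · have hφc : Tendsto φ (𝓝 (x₀, 0)) (𝓝 (restPieces S.θ x₀)) := hφ0 ▸ hφ.continuousAt
    have hmono : ∀ᶠ p in 𝓝 (x₀, (0 : ℝ)), StrictMono (φ p).2 := by
      have : ∀ᶠ w in 𝓝 (restPieces S.θ x₀), ∀ j : Fin (M + 1), w.2 j.castSucc < w.2 j.succ :=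
        eventually_all.2 fun j => ContinuousAt.eventually_lt (by fun_prop) (by fun_prop)
          (S.θ_strictMono x₀ hx₀ Fin.castSucc_lt_succ)
      exact (hφc.eventually this).mono fun p hp => Fin.strictMono_iff_lt_succ.2 hp
    have hmem : ∀ᶠ p in 𝓝 (x₀, (0 : ℝ)), ∀ j u, (φ p).1 j u ∈ Metric.ball x₀ L.δ := by
      filter_upwards [hφc (Metric.ball_mem_nhds _ L.δ_pos)] with p hp j u
      rw [mem_preimage, Metric.mem_ball, Prod.dist_eq] at hp
      have h1 := (dist_le_pi_dist (φ p).1 (restPieces S.θ x₀).1 j).trans_lt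
        ((le_max_left _ _).trans_lt hp)
      exact (ContinuousMap.dist_apply_le_dist u).trans_lt h1
    obtain ⟨η, hη, hηu⟩ := Metric.mem_nhds_iff.1 huniq
    have hclose : ∀ᶠ p in 𝓝 (x₀, (0 : ℝ)),
        (1 + L.K) * (‖p.1 - x₀‖ + L.C * |p.2| * S.T) < η :=
      ContinuousAt.eventually_lt (by fun_prop) continuousAt_const (by simpa using hη)
    filter_upwards [hfix, hmono, hmem, L.eventually_small, hclose, Metric.ball_mem_nhds _ hη]
      with p hpfix hpmono hpmem hpsmall hpclose hpη
    obtain ⟨ξ, ε⟩ := p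
    obtain ⟨hε, hδ, hκ⟩ := hpsmall
    have hξD : ξ ∈ S.D := by
      refine L.subset_D (mem_closedBall_iff_norm.2 ?_)
      have : 0 ≤ L.C * |ε| * S.T :=
        mul_nonneg (mul_nonneg L.C_nonneg (abs_nonneg ε)) S.T_pos.le
      linarith
    have hτ : ∀ k, S.θ k (ξ + ε • increment L.h k (ε, φ (ξ, ε))) = (φ (ξ, ε)).2 k := fun k =>
      congrFun (congrArg Prod.snd hpfix) k
    have hz : ∀ j u, ξ + ε • increment L.h j.castSucc (ε, φ (ξ, ε)) +
        ε • zoneIntegral L.h j (ε, φ (ξ, ε)) u = (φ (ξ, ε)).1 j u := fun j u =>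
      DFunLike.congr_fun (congrFun (congrArg Prod.fst hpfix) j) u
    have h0 : (φ (ξ, ε)).2 0 = 0 := by
      rw [← hτ 0]
      simpa [increment] using S.θ_zero ξ hξD
    -- `θ_last = T` is known on `D` only, so the end point of the curve must be located first
    have hlast : (φ (ξ, ε)).2 (Fin.last (M + 1)) = S.T := by
      rw [← hτ]
      refine S.θ_last _ (L.subset_D (Metric.ball_subset_closedBall ?_))
      have h1 : increment L.h (Fin.last (M + 1)) (ε, φ (ξ, ε)) =
          increment L.h (Fin.last M).castSucc (ε, φ (ξ, ε)) +
            zoneIntegral L.h (Fin.last M) (ε, φ (ξ, ε)) 1 := by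
        rw [← Fin.succ_last]
        exact sum_castSucc_lt_succ _ _
      rw [h1, smul_add, ← add_assoc, hz]
      exact hpmem _ _
    obtain ⟨x, hx0, hx, hxT⟩ :=
      LocalData.exists_isOrbit_of_piecesMap_eq hpmono h0 hlast hpmem hpfix
    -- an orbit starting at `ξ` is close to the rest position, hence is the fixed point `φ`
    have hpieces : ∀ (y : ℝ → EuclideanSpace ℝ (Fin d)) (τ : Fin (M + 2) → ℝ)
        (hy : L.IsOrbit ε y τ), y 0 = ξ → hy.pieces = φ (ξ, ε) := by
      rintro y τ hy rfl
      have hin : ((y 0, ε), hy.pieces) ∈ Metric.ball ((x₀, (0 : ℝ)), restPieces S.θ x₀) η := by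
        rw [← ball_prod_same]
        exact ⟨hpη, (hy.dist_pieces_le hε).trans_lt hpclose⟩
      exact hηu hin hy.piecesMap_eq
    refine ⟨x, hx.isSolution hε hκ, hx0, hxT, fun y hy hy0 => ?_⟩
    obtain ⟨τ, hyτ⟩ := L.exists_isOrbit hy (by rw [hy0]; exact ⟨hε, hδ, hκ⟩)
    exact hyτ.eqOn hx ((hpieces y τ hyτ hy0).trans (hpieces x _ hx hx0).symm)

theorem IsSolution.congr_of_eqOn {ε : ℝ} {x y : ℝ → EuclideanSpace ℝ (Fin d)}
    (hx : S.IsSolution ε x) (hxy : EqOn x y (Icc 0 S.T)) : S.IsSolution ε y := by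
  obtain ⟨hD, v, hv, hvel, hint⟩ := hx
  refine ⟨fun t ht => hxy ht ▸ hD t ht, v, hv, ?_, fun t ht => ?_⟩
  · filter_upwards [hvel] with t h ht using hxy ht ▸ h ht
  · rw [← hxy ht, ← hxy ⟨le_rfl, S.T_pos.le⟩]
    exact hint t ht

/-- A solution on `[0, T]` with equal ends coincides there with a periodic one. -/
theorem exists_isPeriodicSolution {ε : ℝ} {x : ℝ → EuclideanSpace ℝ (Fin d)}
    (hx : S.IsSolution ε x) (hT : x S.T = x 0) :
    ∃ y, S.IsPeriodicSolution ε y ∧ EqOn x y (Icc 0 S.T) := by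
  have hxy : EqOn x (fun t => x (toIcoMod S.T_pos 0 t)) (Icc 0 S.T) := by
    intro t ht
    rcases ht.2.lt_or_eq with h | rfl
    · simp only
      rw [(toIcoMod_eq_self S.T_pos).2 ⟨ht.1, by simpa using h⟩]
    · simp only
      have h := toIcoMod_apply_right S.T_pos 0
      rw [zero_add] at h
      rw [h, hT]
  exact ⟨_, ⟨fun t => by simp only [toIcoMod_add_right],
    hx.congr_of_eqOn hxy⟩, hxy⟩

theorem periodic_eq_of_eqOn {T : ℝ} (hT : 0 < T) {E : Type} {x y : ℝ → E}
    (hx : Function.Periodic x T) (hy : Function.Periodic y T) (hxy : EqOn x y (Icc 0 T)) :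
    x = y := by
  ext t
  have hmod : ∀ {f : ℝ → E}, Function.Periodic f T → f t = f (toIcoMod hT 0 t) := fun hf =>
    (hf.sub_zsmul_eq _).symm
  have hmem := toIcoMod_mem_Ico hT 0 t
  rw [zero_add] at hmem
  rw [hmod hx, hmod hy, hxy (Ico_subset_Icc_self hmem)]

/-- A `T`-periodic branch at a simple zero of a Melnikov function: the zeros of the displacement
quotient `Q` near `a` are followed by `exists_zero_branch`. -/
theorem hasUniquePeriodicBranch_of_zero_branch {a : EuclideanSpace ℝ (Fin d)}
    {Q : EuclideanSpace ℝ (Fin d) × ℝ → EuclideanSpace ℝ (Fin d)}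
    (hQ : ∀ᶠ p in 𝓝 (a, (0 : ℝ)), ∃ x, S.IsSolution p.2 x ∧ x 0 = p.1 ∧
      x S.T = p.1 + p.2 • Q p ∧ ∀ y, S.IsSolution p.2 y → y 0 = p.1 → EqOn y x (Icc 0 S.T))
    (hzero : ∃ ρ₀ > 0, ∀ ρ > 0, ρ ≤ ρ₀ → ∃ ε₁ > 0, ∃ ξ : ℝ → EuclideanSpace ℝ (Fin d),
      (∀ ε : ℝ, ε ≠ 0 → |ε| < ε₁ → ξ ε ∈ Metric.ball a ρ ∧ Q (ξ ε, ε) = 0 ∧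
        ∀ y ∈ Metric.ball a ρ, Q (y, ε) = 0 → y = ξ ε) ∧
      Tendsto ξ (𝓝[≠] 0) (𝓝 a)) : S.HasUniquePeriodicBranch a := by
  obtain ⟨δ, hδ, hδQ⟩ := Metric.mem_nhds_iff.1 hQ
  obtain ⟨ρ₀, hρ₀, hz⟩ := hzero
  obtain ⟨ε₁, hε₁, ξ, hξ, hlim⟩ := hz (min ρ₀ δ) (lt_min hρ₀ hδ) (min_le_left _ _)
  have hin : ∀ y ∈ Metric.ball a (min ρ₀ δ), ∀ ε : ℝ, |ε| < min ε₁ δ →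
      (y, ε) ∈ Metric.ball (a, (0 : ℝ)) δ := by
    intro y hy ε hε
    rw [← ball_prod_same]
    exact ⟨Metric.ball_subset_ball (min_le_right _ _) hy, by
      simpa using hε.trans_le (min_le_right _ _)⟩
  have hex : ∀ ε : ℝ, ∃ x : ℝ → EuclideanSpace ℝ (Fin d), ε ≠ 0 → |ε| < min ε₁ δ →
      S.IsPeriodicSolution ε x ∧ x 0 = ξ ε := by
    intro ε
    by_cases h : ε ≠ 0 ∧ |ε| < min ε₁ δ
    · obtain ⟨h0, h1⟩ := h
      obtain ⟨hmem, hQ0, -⟩ := hξ ε h0 (h1.trans_le (min_le_left _ _))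
      obtain ⟨x, hx, hx0, hxT, -⟩ := hδQ (hin _ hmem ε h1)
      obtain ⟨y, hy, hxy⟩ := exists_isPeriodicSolution hx (by
        simp only at hx0 hxT
        rw [hxT, hx0, hQ0, smul_zero, add_zero])
      exact ⟨y, fun _ _ => ⟨hy, by rw [← hxy ⟨le_rfl, S.T_pos.le⟩, hx0]⟩⟩
    · exact ⟨0, fun h0 h1 => absurd ⟨h0, h1⟩ h⟩
  choose x hx using hex
  have hlt : ∀ ε : ℝ, |ε| < min ε₁ δ → |ε| < ε₁ := fun ε h => h.trans_le (min_le_left _ _)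
  refine ⟨min ε₁ δ, lt_min hε₁ hδ, min ρ₀ δ, lt_min hρ₀ hδ, x, fun ε h0 h1 => ?_, ?_⟩
  · obtain ⟨hxp, hx0⟩ := hx ε h0 h1
    obtain ⟨hmem, hQ0, huniq⟩ := hξ ε h0 (hlt ε h1)
    refine ⟨hxp, hx0 ▸ hmem, fun y hy hyball => ?_⟩
    obtain ⟨x', hx', hx'0, hx'T, hu⟩ := hδQ (hin _ hyball ε h1)
    have hyT : y S.T = y 0 := by simpa using hy.periodic 0
    have hQy : Q (y 0, ε) = 0 := by
      have h2 := hu y hy.isSolution rfl ⟨S.T_pos.le, le_rfl⟩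
      rw [hyT, hx'T] at h2
      exact (smul_eq_zero.1 (left_eq_add.1 h2)).resolve_left h0
    have hy0 : y 0 = ξ ε := huniq _ hyball hQy
    refine periodic_eq_of_eqOn S.T_pos hy.periodic hxp.periodic fun t ht => ?_
    rw [hu y hy.isSolution rfl ht, hu (x ε) hxp.isSolution (hx0.trans hy0.symm) ht]
  · refine hlim.congr' ?_
    have hnear : ∀ᶠ ε in 𝓝 (0 : ℝ), |ε| < min ε₁ δ :=
      ContinuousAt.eventually_lt (by fun_prop) continuousAt_const (by simpa using ⟨hε₁, hδ⟩)
    filter_upwards [nhdsWithin_le_nhds hnear, self_mem_nhdsWithin] with ε h1 h0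
    exact (hx ε h0 h1).2.symm

end NonsmoothSystem

/-! ### Zeros of the displacement and the Melnikov functions -/

/-- `exists_zero_branch` for a `C²` map `G` whose `ε`-derivative at `ε = 0` is `g`. -/
theorem exists_zero_branch_of_contDiffAt {E : Type} [NormedAddCommGroup E] [NormedSpace ℝ E]
    [FiniteDimensional ℝ E] {G : E × ℝ → E} {g : E → E} {a : E} (hG : ContDiffAt ℝ 2 G (a, 0))
    (hG0 : ∀ᶠ x in 𝓝 a, G (x, 0) = 0)
    (hg : ∀ᶠ x in 𝓝 a, HasDerivAt (fun ε => G (x, ε)) (g x) 0) (hga : g a = 0)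
    (hdet : (fderiv ℝ g a).det ≠ 0) :
    ∃ ρ₀ > 0, ∀ ρ > 0, ρ ≤ ρ₀ → ∃ ε₁ > 0, ∃ ξ : ℝ → E,
      (∀ ε : ℝ, ε ≠ 0 → |ε| < ε₁ → ξ ε ∈ Metric.ball a ρ ∧ G (ξ ε, ε) = 0 ∧
        ∀ y ∈ Metric.ball a ρ, G (y, ε) = 0 → y = ξ ε) ∧
      Tendsto ξ (𝓝[≠] 0) (𝓝 a) := by
  have : CompleteSpace E := FiniteDimensional.complete ℝ E
  set H : E × ℝ → E := fun p => fderiv ℝ G p (0, 1) with hH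
  have hderiv : ∀ p, DifferentiableAt ℝ G p → HasDerivAt (fun e => G (p.1, e)) (H p) p.2 :=
    fun p hp => hp.hasFDerivAt.comp_hasDerivAt p.2
      ((hasDerivAt_const p.2 p.1).prodMk (hasDerivAt_id p.2))
  have hGd : ∀ᶠ p in 𝓝 (a, (0 : ℝ)), DifferentiableAt ℝ G p :=
    (hG.eventually (by decide)).mono fun p hp => hp.differentiableAt (by norm_num)
  have hH1 : ContDiffAt ℝ 1 H (a, 0) :=
    (hG.fderiv_right (m := 1) (by norm_num)).clm_apply contDiffAt_const
  have hHs := hH1.hasStrictFDerivAt (by norm_num)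
  have hpoint : Tendsto (fun x : E => (x, (0 : ℝ))) (𝓝 a) (𝓝 (a, 0)) :=
    Continuous.tendsto (by fun_prop) a
  have hHg : ∀ᶠ x in 𝓝 a, g x = H (x, 0) := by
    filter_upwards [hg, hpoint.eventually hGd] with x hx hxd
    exact hx.unique (hderiv _ hxd)
  have hlin : ∀ x, fderiv ℝ g a x = fderiv ℝ H (a, 0) (x, 0) := by
    intro x
    have h1 : HasFDerivAt (fun x => H (x, 0)) (fderiv ℝ H (a, 0) ∘L .inl ℝ E ℝ) a :=
      hHs.hasFDerivAt.comp a (f := fun x => (x, (0 : ℝ))) (hasFDerivAt_prodMk_left a (0 : ℝ))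
    rw [Filter.EventuallyEq.fderiv_eq hHg, h1.fderiv]
    rfl
  refine exists_zero_branch ((fderiv ℝ g a).toContinuousLinearEquivOfDetNeZero hdet)
    (hGd.mono fun p hp => hderiv p hp) hG0 hHs (fun x => ?_) ?_
  · rw [ContinuousLinearMap.toContinuousLinearEquivOfDetNeZero_apply, hlin]
  · rw [← hHg.self_of_nhds, hga]

/-- Taylor's formula of order two, in the form of an estimate. -/
theorem isBigO_sub_sub_smul_sq {E : Type} [NormedAddCommGroup E] [NormedSpace ℝ E] {q : ℝ → E}
    {q' : E} (hq : ContDiffAt ℝ 2 q 0) (hq' : HasDerivAt q q' 0) :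
    (fun ε => q ε - q 0 - ε • q') =O[𝓝 0] fun ε : ℝ => ε ^ 2 := by
  have hd : ∀ᶠ e in 𝓝 (0 : ℝ), HasDerivAt q (deriv q e) e :=
    (hq.eventually (by decide)).mono fun e he => (he.differentiableAt (by norm_num)).hasDerivAt
  have h1 : ContDiffAt ℝ 1 (deriv q) 0 := by
    have : deriv q = fun e => fderiv ℝ q e 1 := by ext e; simp
    rw [this]
    exact (hq.fderiv_right (m := 1) (by norm_num)).clm_apply contDiffAt_const
  obtain ⟨C, hC⟩ := ((h1.differentiableAt (by norm_num)).isBigO_sub).bound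
  obtain ⟨δ, hδ, hδs⟩ := Metric.mem_nhds_iff.1 (hC.and hd)
  rw [isBigO_iff]
  refine ⟨C, ?_⟩
  filter_upwards [Metric.ball_mem_nhds (0 : ℝ) hδ] with ε hε
  have hsub : Metric.closedBall (0 : ℝ) |ε| ⊆ Metric.ball 0 δ :=
    Metric.closedBall_subset_ball (by simpa using hε)
  have hC0 : 0 ≤ C ∨ ε = 0 := by
    by_cases h : ε = 0
    · exact Or.inr h
    · left
      have h2 := (norm_nonneg _).trans (hδs hε).1
      rw [sub_zero] at h2
      exact nonneg_of_mul_nonneg_left h2 (norm_pos_iff.2 h)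
  rcases hC0 with hC0 | rfl
  · have key := (convex_closedBall (0 : ℝ) |ε|).norm_image_sub_le_of_norm_hasDerivWithin_le
      (f := fun e => q e - e • q') (f' := fun e => deriv q e - q') (C := C * |ε|) (x := 0) (y := ε)
      (fun e he => by
        have h := (hδs (hsub he)).2.sub ((hasDerivAt_id e).smul_const q')
        rw [one_smul] at h
        exact h.hasDerivWithinAt)
      (fun e he => by
        have h := (hδs (hsub he)).1
        rw [hq'.deriv, sub_zero, Real.norm_eq_abs] at h
        exact h.trans (mul_le_mul_of_nonneg_left (by simpa using he) hC0))
      (Metric.mem_closedBall_self (abs_nonneg ε)) (by simp)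
    calc ‖q ε - q 0 - ε • q'‖ = ‖(q ε - ε • q') - (q 0 - (0 : ℝ) • q')‖ := by
          congr 1; rw [zero_smul]; abel
      _ ≤ C * |ε| * ‖ε - 0‖ := key
      _ = C * ‖ε ^ 2‖ := by rw [sub_zero, norm_pow, Real.norm_eq_abs]; ring
  · simp

theorem theoremB (d N M r : ℕ) (hN : 1 ≤ N) (hr : N + 1 ≤ r) (S : NonsmoothSystem d N M r) :
    -- `Δ₁`, `Δ₂` are the Melnikov functions: the coefficients of `ε`, `ε²` in the displacement
    (∀ x₀ ∈ S.D, ∃ δ : ℝ → EuclideanSpace ℝ (Fin d),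
      (∀ᶠ ε in 𝓝 0, S.HasDisplacement x₀ ε (δ ε)) ∧
      (fun ε => δ ε - ε • S.Δ₁ x₀) =O[𝓝 0] (fun ε : ℝ => ε ^ 2) ∧
      (2 ≤ N → (fun ε => δ ε - (ε • S.Δ₁ x₀ + ε ^ 2 • S.Δ₂ x₀)) =O[𝓝 0] (fun ε : ℝ => ε ^ 3))) ∧
    -- first order
    (∀ a ∈ S.D, S.Δ₁ a = 0 → (fderiv ℝ S.Δ₁ a).det ≠ 0 → S.HasUniquePeriodicBranch a) ∧
    -- second order
    (2 ≤ N → (∀ x ∈ S.D, S.Δ₁ x = 0) →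
      ∀ a ∈ S.D, S.Δ₂ a = 0 → (fderiv ℝ S.Δ₂ a).det ≠ 0 → S.HasUniquePeriodicBranch a) := by
  have hr2 : 2 ≤ r := by omega
  refine ⟨fun x₀ hx₀ => ?_, fun a ha hΔ hdet => ?_, fun hN2 hΔ₁ a ha hΔ hdet => ?_⟩
  · obtain ⟨Q, hQ, hQ1, hQ2, hsol⟩ := S.exists_displacement_quotient hN hr2 hx₀
    have hline : Tendsto (fun ε : ℝ => (x₀, ε)) (𝓝 0) (𝓝 (x₀, 0)) :=
      Continuous.tendsto (by fun_prop) 0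
    have hq : ContDiffAt ℝ 2 (fun ε : ℝ => Q (x₀, ε)) 0 :=
      hQ.comp (0 : ℝ) (f := fun ε : ℝ => (x₀, ε)) (by fun_prop)
    refine ⟨fun ε => ε • Q (x₀, ε), ?_, ?_, fun hN2 => ?_⟩
    · filter_upwards [hline.eventually hsol] with ε hε
      obtain ⟨x, hx, hx0, hxT, hu⟩ := hε
      refine ⟨⟨x, hx, hx0⟩, fun y hy hy0 => ?_⟩
      rw [hu y hy hy0 ⟨S.T_pos.le, le_rfl⟩, hxT, add_sub_cancel_left]
    · have h := (isBigO_refl (fun ε : ℝ => ε) (𝓝 0)).smul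
        (hq.differentiableAt (by norm_num)).isBigO_sub
      refine (h.congr_left fun ε => ?_).congr_right fun ε => ?_
      · rw [hQ1.self_of_nhds, smul_sub]
      · rw [sub_zero, smul_eq_mul, sq]
    · have h := (isBigO_refl (fun ε : ℝ => ε) (𝓝 0)).smul
        (isBigO_sub_sub_smul_sq hq (hQ2 hN2).self_of_nhds)
      refine (h.congr_left fun ε => ?_).congr_right fun ε => ?_
      · rw [hQ1.self_of_nhds, smul_sub, smul_sub, smul_smul, sq, sub_sub]
      · rw [smul_eq_mul]; ring
  · obtain ⟨Q, hQ, hQ1, -, hsol⟩ := S.exists_displacement_quotient hN hr2 ha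
    have hpoint : Tendsto (fun x : EuclideanSpace ℝ (Fin d) => (x, (0 : ℝ))) (𝓝 a) (𝓝 (a, 0)) :=
      Continuous.tendsto (by fun_prop) a
    obtain ⟨ρ₀, hρ₀, hz⟩ := exists_zero_branch_of_contDiffAt (G := fun p => p.2 • Q p)
      (g := S.Δ₁) (contDiffAt_snd.smul hQ) (by simp) (by
        filter_upwards [hQ1, hpoint.eventually (hQ.eventually (by decide))] with x hx hxQ
        have hd : DifferentiableAt ℝ (fun ε : ℝ => Q (x, ε)) 0 :=
          (hxQ.differentiableAt (by norm_num)).comp (0 : ℝ) (f := fun ε : ℝ => (x, ε))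
            (by fun_prop)
        refine ((hasDerivAt_id (0 : ℝ)).smul hd.hasDerivAt).congr_deriv ?_
        simp [hx]) hΔ hdet
    refine S.hasUniquePeriodicBranch_of_zero_branch hsol ⟨ρ₀, hρ₀, fun ρ hρ hρρ₀ => ?_⟩
    obtain ⟨ε₁, hε₁, ξ, hξ, hlim⟩ := hz ρ hρ hρρ₀
    refine ⟨ε₁, hε₁, ξ, fun ε h0 h1 => ?_, hlim⟩
    obtain ⟨h2, h3, h4⟩ := hξ ε h0 h1
    exact ⟨h2, (smul_eq_zero.1 h3).resolve_left h0, fun y hy hQy =>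
      h4 y hy (by simp only [hQy, smul_zero])⟩
  · obtain ⟨Q, hQ, hQ1, hQ2, hsol⟩ := S.exists_displacement_quotient hN hr2 ha
    refine S.hasUniquePeriodicBranch_of_zero_branch hsol
      (exists_zero_branch_of_contDiffAt (g := S.Δ₂) hQ ?_ (hQ2 hN2) hΔ hdet)
    filter_upwards [hQ1, S.isOpen_D.mem_nhds ha] with x hx hxD
    rw [hx, hΔ₁ x hxD]
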